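/- All graphs are finite, undirected and without self-loops. Write $P_r$ for the path on $r$ vertices, and $P_1+P_5$ for the disjoint union of $P_1$ and $P_5$; a graph is $(P_1+P_5)$-free if it does not contain $P_1+P_5$ as an induced subgraph. The contraction of an edge $uv$ of a graph deletes $u$ and $v$ and replaces them by a new vertex made adjacent to precisely those remaining vertices that were adjacent to $u$ or to $v$ (without introducing self-loops or multiple edges). A graph $G$ contains a graph $F$ as a contraction if $G$ can be modified into (a graph isomorphic to) $F$ by a possibly empty sequence of edge contractions. The problem Longest Path Contractibility takes as input a connected graph $G$ and a positive integer $k$, and asks whether $G$ contains $P_k$ as a contraction. Theorem. Longest Path Contractibility is polynomial-time solvable for $(P_1+P_5)$-free graphs. That is, there are a deterministic Turing machine and a polynomial $p$ such that, for every connected $(P_1+P_5)$-free graph $G$ and every integer $k\ge 1$, the machine, started on a word consisting of the binary representation of $k$ and the adjacency matrix of $G$, halts within $p(\ell)$ steps, where $\ell$ is the length of this word, and outputs whether $G$ contains $P_k$ as a contraction. -/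

import Mathlib

open Computability

namespace LongestPathContractibility

universe u v

/-- The graph `P₁ + P₅`, where `P_r` denotes the path on `r` vertices and `+` disjoint union. -/
abbrev P1AddP5 : SimpleGraph (Fin 1 ⊕ Fin 5) :=
  SimpleGraph.pathGraph 1 ⊕g SimpleGraph.pathGraph 5

/-- `G` is `H`-free: it does not contain `H` as an induced subgraph. -/
def IsFree {V : Type u} {W : Type v} (H : SimpleGraph W) (G : SimpleGraph V) : Prop :=
  ¬ H.IsIndContained G

/-- The graph obtained by contracting the edge `uv` of `G` on `u`: the vertex `v` is removed, and
`u` (now standing for the merged vertex) is made adjacent to exactly those other vertices that were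
adjacent to `u` or to `v`; no loops or multiple edges arise. -/
def contractEdge {V : Type u} (G : SimpleGraph V) (u v : V) : SimpleGraph {x : V // x ≠ v} where
  Adj x y := x ≠ y ∧
    (G.Adj x y ∨ ((x : V) = u ∧ G.Adj v y) ∨ ((y : V) = u ∧ G.Adj v x))
  symm := ⟨by
    rintro x y ⟨hne, h⟩
    exact ⟨hne.symm, h.imp (fun h => h.symm) Or.symm⟩⟩
  loopless := ⟨fun _ h => h.1 rfl⟩

/-- `HasContraction H G`: the graph `G` contains `H` as a contraction, that is, a finite (possibly
empty) sequence of edge contractions turns `G` into a graph isomorphic to `H`. -/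
inductive HasContraction {W : Type v} (H : SimpleGraph W) :
    {V : Type u} → SimpleGraph V → Prop
  | of_iso {V : Type u} {G : SimpleGraph V} (e : Nonempty (G ≃g H)) : HasContraction H G
  | contract {V : Type u} {G : SimpleGraph V} (u v : V) (huv : G.Adj u v)
      (h : HasContraction H (contractEdge G u v)) : HasContraction H G

/-- An instance of Longest Path Contractibility restricted to `H`-free graphs: a connected `H`-free
graph `G` (on the vertex set `{0, …, n - 1}`) and a positive integer `k`. -/
structure Instance {W : Type v} (H : SimpleGraph W) where
  /-- the number of vertices -/
  n : ℕ
  /-- the graph -/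
  G : SimpleGraph (Fin n)
  connected : G.Connected
  free : IsFree H G
  /-- the number of vertices of the path -/
  k : ℕ
  k_pos : 0 < k

/-- The question: does `G` contain the path `P_k` on `k` vertices as a contraction? -/
def Instance.IsYes {W : Type v} {H : SimpleGraph W} (I : Instance H) : Prop :=
  HasContraction (SimpleGraph.pathGraph I.k) I.G

open Classical in
/-- The adjacency matrix of a graph on `{0, …, n - 1}`, written row by row with one bit per entry,
each row being closed by a comma. -/
noncomputable def encodeGraph {n : ℕ} (G : SimpleGraph (Fin n)) : List Γ' :=
  (List.finRange n).flatMap fun i =>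
    (List.finRange n).map (fun j => Γ'.bit (decide (G.Adj i j))) ++ [Γ'.comma]

/-- The input word of an instance: `k` in binary, a comma, and the adjacency matrix of `G`. -/
noncomputable def Instance.encode {W : Type v} {H : SimpleGraph W} (I : Instance H) : List Γ' :=
  (encodeNat I.k).map Γ'.bit ++ Γ'.comma :: encodeGraph I.G

open Classical in
/-- Longest Path Contractibility is polynomial-time solvable on `H`-free graphs: there are a Turing
machine and a polynomial `p` such that on the input word of every instance, the machine halts
within `p (length of the input word)` steps and outputs the correct answer (one bit). -/
def PolyTimeSolvable {W : Type v} (H : SimpleGraph W) : Prop :=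
  Nonempty (Turing.TM2ComputableInPolyTime (Instance.encode (H := H)) encodeBool
    (fun I : Instance H => decide I.IsYes))

end LongestPathContractibility

/-! ### Structured programs and their compilation to a multi-stack machine. -/

namespace LongestPathContractibility

open Turing Function

/-! A `(P₁ + P₅)`-free graph has no induced path on seven vertices: its first five vertices together
with the seventh would induce `P₁ + P₅`. Two consequences follow. A connected set of vertices has
diameter at most five inside itself, so a contraction to `P_k` forces `k ≤ 6` (`IsFree.le_six`).
Moreover, connectedness of a definable set, and the union of those components of a definable set
that meet a given definable set, can be expressed by first-order formulas.

The graph-theoretic core (`IsFree.exists_labels`) is that a graph contractible to `P_k` with `k ≤ 6`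
has such a contraction whose bags are first-order definable from ten vertices. The end bags may be
taken to be single vertices `x` and `y`. For `k ≥ 4`, the neighbours of `x` lie in the second bag
and become connected after adding at most two vertices of that bag (`IsFree.exists_conn_nbr`); call
the result `A`, and let `B` be its counterpart for `y`. For `k = 4`, all remaining components
adjacent to `A` are joined to `A` and the others stay with `B`. For `k ≥ 5`, the components outside
`{x, y} ∪ A ∪ B` are sorted into those adjacent to `A` only, to `B` only, and to both. The first two
kinds enlarge the second and the last but one bag; the third kind forms the middle part, which is
connected and contains all inner bags. For `k = 5` it is the third bag. For `k = 6` it must be cut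
in two: again two vertices suffice to connect the neighbours of `A` in it, likewise for `B`, and the
cut is made as for `k = 4`.

Hence being a yes-instance is a first-order property of the graph together with a digest of `k` that
identifies each `k ≤ 6` (`definable_isYes`). A fixed first-order formula is evaluated in polynomial
time by nested loops over unary counters that walk through the adjacency matrix (`polyTime_of_fml`).
-/

/-- Structured programs acting on a finite control state `σ` and on memory indexed by `S`. -/
inductive Prog (S σ : Type) : Type
  | push (k : S) (f : σ → Γ')
  | pop (k : S) (f : σ → Option Γ' → σ)
  | peek (k : S) (f : σ → Option Γ' → σ)
  | load (f : σ → σ)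
  | seq (p q : Prog S σ)
  | ite (c : σ → Bool) (p q : Prog S σ)
  | loop (c : σ → Bool) (p : Prog S σ)

namespace Prog

variable {S σ : Type} [DecidableEq S]

/-- The big-step semantics of programs, with the exact number of machine steps. -/
inductive Exec : Prog S σ → σ × (S → List Γ') → σ × (S → List Γ') → ℕ → Prop
  | push {k f v m} : Exec (.push k f) (v, m) (v, update m k (f v :: m k)) 1
  | pop {k f v m} : Exec (.pop k f) (v, m) (f v (m k).head?, update m k (m k).tail) 1
  | peek {k f v m} : Exec (.peek k f) (v, m) (f v (m k).head?, m) 1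
  | load {f v m} : Exec (.load f) (v, m) (f v, m) 1
  | seq {p q s s' s'' t t'} : Exec p s s' t → Exec q s' s'' t' → Exec (.seq p q) s s'' (t + t')
  | ite_true {c p q s s' t} : c s.1 = true → Exec p s s' t → Exec (.ite c p q) s s' (1 + t)
  | ite_false {c p q s s' t} : c s.1 = false → Exec q s s' t → Exec (.ite c p q) s s' (1 + t)
  | loop_false {c p s} : c s.1 = false → Exec (.loop c p) s s 1
  | loop_true {c p s s' s'' t t'} : c s.1 = true → Exec p s s' t →
      Exec (.loop c p) s' s'' t' → Exec (.loop c p) s s'' (1 + (t + t'))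

/-- The program positions of a program, used as labels of the compiled machine. -/
def Lab : Prog S σ → Type
  | push _ _ | pop _ _ | peek _ _ | load _ => Unit
  | seq p q => Lab p ⊕ Lab q
  | ite _ p q => Option (Lab p ⊕ Lab q)
  | loop _ p => Option (Lab p)

instance labFintype : (p : Prog S σ) → Fintype p.Lab
  | push _ _ | pop _ _ | peek _ _ | load _ => inferInstanceAs (Fintype Unit)
  | seq p q => @instFintypeSum _ _ (labFintype p) (labFintype q)
  | ite _ p q => @instFintypeOption _ (@instFintypeSum _ _ (labFintype p) (labFintype q))
  | loop _ p => @instFintypeOption _ (labFintype p)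

/-- The first position of a program. -/
def start : (p : Prog S σ) → p.Lab
  | push _ _ | pop _ _ | peek _ _ | load _ => ()
  | seq p _ => .inl p.start
  | ite _ _ _ => none
  | loop _ _ => none

/-- The alphabets of the compiled machine: an output stack over `Bool`, all others over `Γ'`. -/
def Alph (S : Type) : Option S → Type
  | none => Bool
  | some _ => Γ'

/-- The memory of the compiled machine, the output stack being empty. -/
def memory (m : S → List Γ') : (k : Option S) → List (Alph S k)
  | none => []
  | some k => m k

theorem update_memory (m : S → List Γ') (k : S) (l : List Γ') :
    update (memory m) (some k) l = memory (update m k l) := by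
  funext j
  cases j with
  | none => exact update_of_ne (by simp) _ _
  | some j =>
    by_cases h : j = k
    · subst h
      refine (update_self _ _ _).trans ?_
      change l = update m j l j
      rw [update_self]
    · refine (update_of_ne (by simpa using h) _ _).trans ?_
      change m j = update m k l j
      rw [update_of_ne h]

/-- The machine code of a program whose positions are embedded into `Λ` by `e`, and which
continues at `x` when it ends. -/
def code {Λ : Type} : (p : Prog S σ) → (p.Lab → Λ) → Λ → p.Lab → TM2.Stmt (Alph S) Λ σ
  | push k f, _, x, _ => .push (some k) f (.goto fun _ => x)
  | pop k f, _, x, _ => .pop (some k) f (.goto fun _ => x)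
  | peek k f, _, x, _ => .peek (some k) f (.goto fun _ => x)
  | load f, _, x, _ => .load f (.goto fun _ => x)
  | seq p q, e, _, .inl l => p.code (fun l => e (.inl l)) (e (.inr q.start)) l
  | seq _ q, e, x, .inr l => q.code (fun l => e (.inr l)) x l
  | ite c p q, e, _, none =>
      .branch c (.goto fun _ => e (some (.inl p.start))) (.goto fun _ => e (some (.inr q.start)))
  | ite _ p _, e, x, some (.inl l) => p.code (fun l => e (some (.inl l))) x l
  | ite _ _ q, e, x, some (.inr l) => q.code (fun l => e (some (.inr l))) x l
  | loop c p, e, x, none => .branch c (.goto fun _ => e (some p.start)) (.goto fun _ => x)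
  | loop _ p, e, _, some l => p.code (fun l => e (some l)) (e none) l

/-- `t` steps of the machine `M` lead from `c` to `c'`. -/
def Steps {Λ : Type} (M : Λ → TM2.Stmt (Alph S) Λ σ) (t : ℕ)
    (c c' : TM2.Cfg (Alph S) Λ σ) : Prop :=
  (flip bind (TM2.step M))^[t] (some c) = some c'

theorem Steps.trans {Λ : Type} {M : Λ → TM2.Stmt (Alph S) Λ σ} {t t' : ℕ}
    {c c' c'' : TM2.Cfg (Alph S) Λ σ} (h : Steps M t c c') (h' : Steps M t' c' c'') :
    Steps M (t + t') c c'' := by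
  unfold Steps at *
  rw [Nat.add_comm, iterate_add_apply, h, h']

theorem Steps.one {Λ : Type} {M : Λ → TM2.Stmt (Alph S) Λ σ} {l : Λ} {v : σ}
    {m : (k : Option S) → List (Alph S k)} {c : TM2.Cfg (Alph S) Λ σ}
    (h : TM2.stepAux (M l) v m = c) : Steps M 1 ⟨some l, v, m⟩ c := by
  subst h; rfl

/-- The machine is arbitrary and only has to agree with the code of `p` on the positions of `p`.
This makes the induction work: a subprogram lives in the same machine, with a narrower embedding of
positions and with the beginning of the next part, or the loop test, as its exit. -/
theorem Exec.steps {p : Prog S σ} {s s' : σ × (S → List Γ')} {t : ℕ} (h : Exec p s s' t) :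
    ∀ {Λ : Type} (M : Λ → TM2.Stmt (Alph S) Λ σ) (e : p.Lab → Λ) (x : Λ),
      (∀ l, M (e l) = p.code e x l) →
      Steps M t ⟨some (e p.start), s.1, memory s.2⟩ ⟨some x, s'.1, memory s'.2⟩ := by
  induction h with
  | push =>
    intro Λ M e x hM
    refine Steps.one ?_
    rw [hM]
    simp only [code, TM2.stepAux]
    erw [update_memory]
    rfl
  | pop =>
    intro Λ M e x hM
    refine Steps.one ?_
    rw [hM]
    simp only [code, TM2.stepAux]
    erw [update_memory]
    rfl
  | peek =>
    intro Λ M e x hM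
    refine Steps.one ?_
    rw [hM]
    rfl
  | load =>
    intro Λ M e x hM
    refine Steps.one ?_
    rw [hM]
    rfl
  | seq _ _ ih ih' =>
    intro Λ M e x hM
    exact (ih M _ _ fun l => hM (.inl l)).trans (ih' M _ _ fun l => hM (.inr l))
  | ite_true hc _ ih =>
    intro Λ M e x hM
    refine (Steps.one ?_).trans (ih M _ _ fun l => hM (some (.inl l)))
    erw [hM none]
    simp [code, hc]
  | ite_false hc _ ih =>
    intro Λ M e x hM
    refine (Steps.one ?_).trans (ih M _ _ fun l => hM (some (.inr l)))
    erw [hM none]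
    simp [code, hc]
  | loop_false hc =>
    intro Λ M e x hM
    refine Steps.one ?_
    erw [hM none]
    simp [code, hc]
  | loop_true hc _ _ ih ih' =>
    intro Λ M e x hM
    refine (Steps.one ?_).trans ((ih M _ _ fun l => hM (some l)).trans (ih' M e x hM))
    erw [hM none]
    simp [code, hc]

/-- The machine that runs the program `p` from the control state `v₀`, the input being on the stack
`k₀`, and then outputs the bit `out` of the control state. -/
def machine [Fintype S] [Fintype σ] (p : Prog S σ) (k₀ : S) (v₀ : σ) (out : σ → Bool) : FinTM2 where
  K := Option S
  k₀ := some k₀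
  k₁ := none
  Γ := Alph S
  Λ := Option p.Lab
  main := some p.start
  σ := σ
  initialState := v₀
  Γk₀Fin := inferInstanceAs (Fintype Γ')
  m
    | some l => p.code some none l
    | none => .push none out (.load (fun _ => v₀) .halt)

/-- A program that answers a question within polynomial time, and cleans up its memory, yields a
polynomial-time Turing machine. -/
theorem polyTime_of_exec [Fintype S] [Fintype σ] {α : Type} (ea : α → List Γ') (f : α → Bool)
    (p : Prog S σ) (k₀ : S) (v₀ : σ) (out : σ → Bool) (T : Polynomial ℕ)
    (h : ∀ a, ∃ v t, t ≤ T.eval (ea a).length ∧ out v = f a ∧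
      Exec p (v₀, update (fun _ => []) k₀ (ea a)) (v, fun _ => []) t) :
    Nonempty (TM2ComputableInPolyTime ea encodeBool f) := by
  refine ⟨⟨⟨p.machine k₀ v₀ out, Equiv.refl Γ', Equiv.refl Bool⟩, T + 1, fun a => Nonempty.some ?_⟩⟩
  obtain ⟨v, t, ht, hv, hp⟩ := h a
  have h1 := hp.steps (p.machine k₀ v₀ out).m some none fun l => rfl
  -- A halting configuration must carry the initial control state and have all stacks but the output
  -- empty. So the last step also restores `v₀`, and the program itself must have emptied its
  -- memory. This step accounts for the `+ 1` in the polynomial.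
  have h2 : Steps (p.machine k₀ v₀ out).m 1 ⟨some none, v, memory fun _ => []⟩
      ⟨none, v₀, update (memory fun _ => []) none [f a]⟩ := by
    refine Steps.one ?_
    simp only [machine, TM2.stepAux, hv]
    rfl
  have h3 := h1.trans h2
  refine ⟨⟨⟨t + 1, ?_⟩, ?_⟩⟩
  · have e1 : initList (p.machine k₀ v₀ out)
        (List.map (Equiv.refl Γ').invFun (ea a)) =
        ⟨some (some p.start), v₀, memory (update (fun _ => []) k₀ (ea a))⟩ := by
      unfold initList
      congr 1
      funext k
      cases k with
      | none => rfl
      | some k =>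
        by_cases hk : k = k₀
        · subst hk
          refine (dif_pos rfl).trans ?_
          change List.map id (ea a) = update (fun _ => []) k (ea a) k
          rw [update_self, List.map_id]
        · refine (dif_neg fun h => hk (Option.some.inj h)).trans ?_
          change [] = update (fun _ => []) k₀ (ea a) k
          rw [update_of_ne hk]
    have e2 : haltList (p.machine k₀ v₀ out)
        (List.map (Equiv.refl Bool).invFun (encodeBool (f a))) =
        ⟨none, v₀, update (memory fun _ => []) none [f a]⟩ := by
      unfold haltList
      congr 1
      funext k
      cases k with
      | none => simp [machine, encodeBool]; rfl
      | some k =>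
        refine (dif_neg (Option.some_ne_none k)).trans (Eq.symm ?_)
        exact update_of_ne (Option.some_ne_none k) _ _
    have h4 := h3
    unfold Steps at h4
    erw [e1, Option.map_some, e2]
    exact h4
  · simp only [Polynomial.eval_add, Polynomial.eval_one]
    omega

end Prog

end LongestPathContractibility

/-! ### Time-bounded runs, unary counters, and moving through the matrix. -/

namespace LongestPathContractibility

open Turing Function

namespace Prog

variable {S σ : Type} [DecidableEq S]

/-- The program `p` leads from `s` to `s'` within `T` steps. -/
def Runs (p : Prog S σ) (s s' : σ × (S → List Γ')) (T : ℕ) : Prop :=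
  ∃ t ≤ T, Exec p s s' t

theorem Runs.mono {p : Prog S σ} {s s' : σ × (S → List Γ')} {T T' : ℕ} (h : Runs p s s' T)
    (hT : T ≤ T') : Runs p s s' T' := by
  obtain ⟨t, ht, h⟩ := h
  exact ⟨t, ht.trans hT, h⟩

theorem Runs.seq {p q : Prog S σ} {s s' s'' : σ × (S → List Γ')} {T T' : ℕ} (h : Runs p s s' T)
    (h' : Runs q s' s'' T') : Runs (.seq p q) s s'' (T + T') := by
  obtain ⟨t, ht, h⟩ := h
  obtain ⟨t', ht', h'⟩ := h'
  exact ⟨_, add_le_add ht ht', .seq h h'⟩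

theorem Runs.ite_true {c : σ → Bool} {p q : Prog S σ} {s s' : σ × (S → List Γ')} {T : ℕ}
    (hc : c s.1 = true) (h : Runs p s s' T) : Runs (.ite c p q) s s' (1 + T) := by
  obtain ⟨t, ht, h⟩ := h
  exact ⟨_, by omega, .ite_true hc h⟩

theorem Runs.ite_false {c : σ → Bool} {p q : Prog S σ} {s s' : σ × (S → List Γ')} {T : ℕ}
    (hc : c s.1 = false) (h : Runs q s s' T) : Runs (.ite c p q) s s' (1 + T) := by
  obtain ⟨t, ht, h⟩ := h
  exact ⟨_, by omega, .ite_false hc h⟩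

theorem Runs.loop_false {c : σ → Bool} {p : Prog S σ} {s : σ × (S → List Γ')}
    (hc : c s.1 = false) : Runs (.loop c p) s s 1 :=
  ⟨1, le_rfl, .loop_false hc⟩

theorem Runs.loop_true {c : σ → Bool} {p : Prog S σ} {s s' s'' : σ × (S → List Γ')} {T T' : ℕ}
    (hc : c s.1 = true) (h : Runs p s s' T) (h' : Runs (.loop c p) s' s'' T') :
    Runs (.loop c p) s s'' (1 + (T + T')) := by
  obtain ⟨t, ht, h⟩ := h
  obtain ⟨t', ht', h'⟩ := h'
  exact ⟨_, by omega, .loop_true hc h h'⟩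

theorem runs_push {k : S} {f : σ → Γ'} {v : σ} {m m' : S → List Γ'}
    (h : update m k (f v :: m k) = m') : Runs (.push k f) (v, m) (v, m') 1 := by
  subst h; exact ⟨1, le_rfl, .push⟩

theorem runs_pop {k : S} {f : σ → Option Γ' → σ} {v v' : σ} {m m' : S → List Γ'}
    (hv : f v (m k).head? = v') (h : update m k (m k).tail = m') :
    Runs (.pop k f) (v, m) (v', m') 1 := by
  subst h hv; exact ⟨1, le_rfl, .pop⟩

theorem runs_peek {k : S} {f : σ → Option Γ' → σ} {v v' : σ} {m : S → List Γ'}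
    (hv : f v (m k).head? = v') : Runs (.peek k f) (v, m) (v', m) 1 := by
  subst hv; exact ⟨1, le_rfl, .peek⟩

theorem runs_load {f : σ → σ} {v v' : σ} {m : S → List Γ'} (hv : f v = v') :
    Runs (.load f) (v, m) (v', m) 1 := by
  subst hv; exact ⟨1, le_rfl, .load⟩

end Prog

open Prog

/-- The stacks used to evaluate a formula: the matrix, the part of it that has been read, a unary
scratch counter, and for each variable two unary counters whose sum is the number of vertices, the
first one holding the value of the variable. -/
inductive Stk (M : ℕ) : Type
  | mat
  | tmp
  | scr
  | done (i : Fin (M + 1))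
  | todo (i : Fin (M + 1))
  deriving DecidableEq, Fintype

/-- The control state: the result of the last evaluation, the last symbol read, and a digest of the
number `k`. -/
abbrev Ctl : Type := Bool × Option Γ' × Fin 16

variable {M : ℕ}

/-- The memory with the matrix split into the unread part `A` and the read part `T`, and the given
values of the unary counters. -/
def store (A T : List Γ') (s : ℕ) (E D : Fin (M + 1) → ℕ) : Stk M → List Γ'
  | .mat => A
  | .tmp => T
  | .scr => List.replicate s .blank
  | .done i => List.replicate (E i) .blank
  | .todo i => List.replicate (D i) .blank

section store

variable (A T A' : List Γ') (s s' : ℕ) (E D : Fin (M + 1) → ℕ) (i : Fin (M + 1))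

theorem update_store_mat : update (store A T s E D) .mat A' = store A' T s E D := by
  funext k; cases k <;> simp [store, update]

theorem update_store_tmp : update (store A T s E D) .tmp A' = store A A' s E D := by
  funext k; cases k <;> simp [store, update]

theorem update_store_scr :
    update (store A T s E D) .scr (List.replicate s' .blank) = store A T s' E D := by
  funext k; cases k <;> simp [store, update]

theorem update_store_done :
    update (store A T s E D) (.done i) (List.replicate s' .blank) =
      store A T s (update E i s') D := by
  funext k; cases k with
  | done j => by_cases h : j = i
              · subst h; simp [store]
              · simp [store, h]
  | _ => simp [store]

theorem update_store_todo :
    update (store A T s E D) (.todo i) (List.replicate s' .blank) =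
      store A T s E (update D i s') := by
  funext k; cases k with
  | todo j => by_cases h : j = i
              · subst h; simp [store]
              · simp [store, h]
  | _ => simp [store]

end store

/-- Store the symbol that has been read in the control state. -/
def keep (v : Ctl) (a : Option Γ') : Ctl := (v.1, a, v.2.2)

/-- Has a symbol been read? -/
def hasSym (v : Ctl) : Bool := v.2.1.isSome

/-- The symbol that has been read. -/
def sym (v : Ctl) : Γ' := v.2.1.getD .blank

/-- Pop symbols from the stack `a` until it is empty, running `p` after each of them. -/
def forPop (a : Stk M) (p : Prog (Stk M) Ctl) : Prog (Stk M) Ctl :=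
  .seq (.pop a keep) (.loop hasSym (.seq p (.pop a keep)))

/-- A loop popping unary symbols off a counter, specified by the sequence of its memories. -/
theorem runs_forPop (a : Stk M) (p : Prog (Stk M) Ctl) (b : Bool) (q : Fin 16) (N T : ℕ)
    (m : ℕ → Stk M → List Γ') (hN : m N a = [])
    (hpop : ∀ t < N, ∃ y, (m t a).head? = some y ∧
      ∃ x, Runs p ((b, some y, q), update (m t) a (m t a).tail) ((b, x, q), m (t + 1)) T) (x) :
    Runs (forPop a p) ((b, x, q), m 0) ((b, none, q), m N) (N * (T + 2) + 2) := by
  -- The invariant is taken after the pop: the head of `m t a` is already in the control state and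
  -- gone from the stack. `r` counts the remaining rounds.
  have key : ∀ r t, t + r = N →
      Runs (.loop hasSym (.seq p (.pop a keep)))
        (keep (b, none, q) (m t a).head?, update (m t) a (m t a).tail) ((b, none, q), m N)
        (r * (T + 2) + 1) := by
    intro r
    induction r with
    | zero =>
      intro t ht
      have : t = N := by omega
      subst this
      simp only [hN, List.head?_nil, List.tail_nil, Nat.zero_mul, Nat.zero_add]
      have h : update (m t) a [] = m t := by rw [← hN, update_eq_self]
      rw [h]
      exact Runs.loop_false rfl
    | succ r ih =>
      intro t ht
      obtain ⟨y, hy, x, hx⟩ := hpop t (by omega)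
      rw [hy]
      refine (Runs.loop_true rfl (hx.seq (runs_pop rfl rfl)) (ih (t + 1) (by omega))).mono ?_
      rw [Nat.succ_mul]; omega
  refine ((runs_pop (v := (b, x, q)) rfl rfl).seq (key N 0 (by omega))).mono ?_
  omega

/-- Move the scratch counter back to the counter of the variable `i`. -/
def refill (i : Fin (M + 1)) : Prog (Stk M) Ctl :=
  forPop .scr (.push (.done i) fun _ => .blank)

theorem runs_refill (i : Fin (M + 1)) (b x q A T s) (E D : Fin (M + 1) → ℕ) :
    Runs (refill i) ((b, x, q), store A T s E D)
      ((b, none, q), store A T 0 (update E i (E i + s)) D) (s * 3 + 2) := by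
  have := runs_forPop (M := M) .scr (.push (.done i) fun _ => .blank) b q s 1
    (fun t => store A T (s - t) (update E i (E i + t)) D)
    (by simp [store]) (by
      intro t ht
      obtain ⟨r, hr⟩ : ∃ r, s - t = r + 1 := ⟨s - t - 1, by omega⟩
      refine ⟨.blank, by simp [store, hr, List.replicate_succ], some .blank, ?_⟩
      have e : (store A T (s - t) (update E i (E i + t)) D (Stk.scr)).tail =
        List.replicate (s - (t + 1)) .blank := by
          simp [store, List.tail_replicate]; omega
      rw [e, update_store_scr]
      refine runs_push ?_
      have e' : Γ'.blank :: store A T (s - (t + 1)) (update E i (E i + t)) D (.done i) =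
        List.replicate (E i + (t + 1)) .blank := by
          simp [store, ← List.replicate_succ, Nat.add_assoc]
      rw [e', update_store_done, update_idem]) x
  simpa [refill] using this

/-- Run `p` as often as the value of the variable `i` says. -/
def walk (i : Fin (M + 1)) (p : Prog (Stk M) Ctl) : Prog (Stk M) Ctl :=
  .seq (forPop (.done i) (.seq (.push .scr fun _ => .blank) p)) (refill i)

/-- The popped units are parked on the scratch counter and poured back at the end, so the value of
the variable survives. Meanwhile the counters are in intermediate states, which is why `p` has to
work for every `s` and `E'`. -/
theorem runs_walk (i : Fin (M + 1)) (p : Prog (Stk M) Ctl) (b x q) (A T : ℕ → List Γ')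
    (E D : Fin (M + 1) → ℕ) (Tp : ℕ)
    (hp : ∀ t < E i, ∀ x s E', ∃ x', Runs p ((b, x, q), store (A t) (T t) s E' D)
      ((b, x', q), store (A (t + 1)) (T (t + 1)) s E' D) Tp) :
    Runs (walk i p) ((b, x, q), store (A 0) (T 0) 0 E D)
      ((b, none, q), store (A (E i)) (T (E i)) 0 E D) (E i * (Tp + 6) + 4) := by
  have h1 := runs_forPop (M := M) (.done i) (.seq (.push .scr fun _ => .blank) p) b q (E i)
    (1 + Tp) (fun t => store (A t) (T t) t (update E i (E i - t)) D)
    (by simp [store]) (by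
      intro t ht
      obtain ⟨r, hr⟩ : ∃ r, E i - t = r + 1 := ⟨E i - t - 1, by omega⟩
      obtain ⟨x', hx'⟩ := hp t ht (some .blank) (t + 1) (update E i (E i - (t + 1)))
      refine ⟨.blank, by simp [store, hr, List.replicate_succ], x', ?_⟩
      have e : (store (A t) (T t) t (update E i (E i - t)) D (.done i)).tail =
        List.replicate (E i - (t + 1)) .blank := by
          simp [store, List.tail_replicate]; omega
      rw [e, update_store_done, update_idem]
      refine (runs_push ?_).seq hx'
      exact update_store_scr _ _ _ (t + 1) _ _) x
  have h2 := runs_refill i b none q (A (E i)) (T (E i)) (E i) (update E i (E i - E i)) D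
  simp only [Nat.sub_self, update_self, Nat.zero_add, update_idem, update_eq_self] at h2
  simp only [Nat.sub_self, Nat.sub_zero, update_eq_self] at h1
  refine (h1.seq h2).mono ?_
  ring_nf
  omega

/-- The memory when the first `p` symbols of the matrix have been read. -/
def storeAt (A : List Γ') (p : ℕ) (s : ℕ) (E D : Fin (M + 1) → ℕ) : Stk M → List Γ' :=
  store (A.drop p) (A.take p).reverse s E D

/-- Read a symbol of the matrix. -/
def fwd : Prog (Stk M) Ctl := .seq (.pop .mat keep) (.push .tmp sym)

theorem runs_fwd {A : List Γ'} {p : ℕ} {a : Γ'} (h : A[p]? = some a) (b x q s)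
    (E D : Fin (M + 1) → ℕ) :
    Runs fwd ((b, x, q), storeAt A p s E D) ((b, some a, q), storeAt A (p + 1) s E D) 2 := by
  obtain ⟨hp, rfl⟩ := List.getElem?_eq_some_iff.1 h
  have e1 : (A.drop p).head? = some A[p] := by simp [List.head?_drop]
  refine (runs_pop (v' := (b, some A[p], q)) ?_ (update_store_mat _ _ _ _ _ _)).seq
    (runs_push ((update_store_tmp _ _ _ _ _ _).trans ?_))
  · simp [store, keep]
  · simp only [storeAt, store, sym, List.tail_drop]
    rw [List.take_succ_eq_append_getElem hp, List.reverse_append]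
    rfl

/-- Unread a symbol of the matrix. -/
def back : Prog (Stk M) Ctl := .seq (.pop .tmp keep) (.ite hasSym (.push .mat sym) (.load id))

/-- At the left end nothing happens, in accordance with truncated subtraction. Walking `a` steps
forward and `b` steps back therefore ends at position `a - b`, which is `0` exactly if `a ≤ b`; the
atomic formula `le` is tested in this way. -/
theorem runs_back {A : List Γ'} {p : ℕ} (hp : p ≤ A.length) (b x q s)
    (E D : Fin (M + 1) → ℕ) : ∃ x',
    Runs back ((b, x, q), storeAt A p s E D) ((b, x', q), storeAt A (p - 1) s E D) 3 := by
  cases p with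
  | zero =>
    refine ⟨none, ((runs_pop rfl (update_store_tmp _ _ _ _ _ _)).seq
      (Runs.ite_false ?_ (runs_load ?_))).mono (by omega)⟩ <;> simp [store, hasSym, keep]
  | succ p =>
    have hp : p < A.length := hp
    have e : (A.take (p + 1)).reverse = A[p] :: (A.take p).reverse := by
      rw [List.take_succ_eq_append_getElem hp, List.reverse_append]; rfl
    refine ⟨some A[p], ((runs_pop (v' := (b, some A[p], q)) ?_
      (update_store_tmp _ _ _ _ _ _)).seq (Runs.ite_true rfl (runs_push
      ((update_store_mat _ _ _ _ _ _).trans ?_)))).mono (by omega)⟩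
    · simp [store, e, keep]
    · simp only [storeAt, store, e, sym, List.tail_cons, Nat.add_sub_cancel]
      rw [List.drop_eq_getElem_cons hp]
      rfl

/-- Read the matrix up to and including the next comma. -/
def skipRow : Prog (Stk M) Ctl :=
  .seq (.load fun v => keep v none) (.loop (fun v => decide (v.2.1 ≠ some .comma)) fwd)

/-- The register is cleared first because a comma left there by the previous row would stop the loop
at once. -/
theorem runs_skipRow {A : List Γ'} {p r : ℕ} (hr : ∀ j < r, ∃ c, A[p + j]? = some (.bit c))
    (hc : A[p + r]? = some .comma) (b x q s) (E D : Fin (M + 1) → ℕ) :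
    Runs skipRow ((b, x, q), storeAt A p s E D)
      ((b, some .comma, q), storeAt A (p + r + 1) s E D) (3 * r + 5) := by
  have key : ∀ r p x, x ≠ some Γ'.comma → (∀ j < r, ∃ c, A[p + j]? = some (.bit c)) →
      A[p + r]? = some .comma →
      Runs (.loop (fun v => decide (v.2.1 ≠ some .comma)) fwd) ((b, x, q), storeAt A p s E D)
      ((b, some .comma, q), storeAt A (p + r + 1) s E D) (3 * r + 4) := by
    intro r
    induction r with
    | zero =>
      intro p x hx _ hc
      exact (Runs.loop_true (by simpa using hx) (runs_fwd hc b x q s E D)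
        (Runs.loop_false (by simp))).mono (by omega)
    | succ r ih =>
      intro p x hx hr hc
      obtain ⟨c, h0⟩ := hr 0 (by omega)
      have := ih (p + 1) (some (.bit c)) (by simp)
        (fun j hj => by simpa [Nat.add_assoc, Nat.add_comm 1] using hr (j + 1) (by omega))
        (by rw [← hc]; congr 1; omega)
      refine (Runs.loop_true (by simpa using hx) (runs_fwd h0 b x q s E D) (T' := 3 * r + 4)
        ?_).mono (by omega)
      have e : p + (r + 1) + 1 = p + 1 + r + 1 := by omega
      rw [e]
      exact this
  exact ((runs_load rfl).seq (key r p none (by simp) hr hc)).mono (by omega)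

/-- Unread the whole matrix. -/
def rewind : Prog (Stk M) Ctl := forPop .tmp (.push .mat sym)

theorem runs_rewind {A : List Γ'} {p : ℕ} (hp : p ≤ A.length) (b x q s) (E D : Fin (M + 1) → ℕ) :
    Runs rewind ((b, x, q), storeAt A p s E D) ((b, none, q), storeAt A 0 s E D)
      (p * 3 + 2) := by
  have := runs_forPop (M := M) .tmp (.push .mat sym) b q p 1
    (fun t => storeAt A (p - t) s E D)
    (by simp [storeAt, store]) (by
      intro t ht
      obtain ⟨r, hr⟩ : ∃ r, p - t = r + 1 := ⟨p - t - 1, by omega⟩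
      have hr' : r < A.length := by omega
      have e : (A.take (p - t)).reverse = A[r] :: (A.take r).reverse := by
        rw [hr, List.take_succ_eq_append_getElem hr', List.reverse_append]; rfl
      refine ⟨A[r], by simp [storeAt, store, e], some A[r], ?_⟩
      have e2 : p - (t + 1) = r := by omega
      simp only [storeAt, store, e, e2, List.tail_cons, update_store_tmp]
      refine runs_push ((update_store_mat _ _ _ _ _ _).trans ?_)
      simp only [store, sym, hr]
      rw [List.drop_eq_getElem_cons hr']
      rfl) x
  simpa [rewind] using this

/-- Reset the variable `i`. -/
def reset (i : Fin (M + 1)) : Prog (Stk M) Ctl :=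
  forPop (.done i) (.push (.todo i) fun _ => .blank)

theorem runs_reset (i : Fin (M + 1)) (b x q A T s) (E D : Fin (M + 1) → ℕ) :
    Runs (reset i) ((b, x, q), store A T s E D)
      ((b, none, q), store A T s (update E i 0) (update D i (D i + E i))) (E i * 3 + 2) := by
  have := runs_forPop (M := M) (.done i) (.push (.todo i) fun _ => .blank) b q (E i) 1
    (fun t => store A T s (update E i (E i - t)) (update D i (D i + t)))
    (by simp [store]) (by
      intro t ht
      obtain ⟨r, hr⟩ : ∃ r, E i - t = r + 1 := ⟨E i - t - 1, by omega⟩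
      refine ⟨.blank, by simp [store, hr, List.replicate_succ], some .blank, ?_⟩
      have e : (store A T s (update E i (E i - t)) (update D i (D i + t)) (.done i)).tail =
        List.replicate (E i - (t + 1)) .blank := by
          simp [store, List.tail_replicate]; omega
      rw [e, update_store_done, update_idem]
      refine runs_push ?_
      have e' : Γ'.blank :: store A T s (update E i (E i - (t + 1))) (update D i (D i + t))
          (.todo i) = List.replicate (D i + (t + 1)) .blank := by
          simp [store, ← List.replicate_succ, Nat.add_assoc]
      rw [e', update_store_todo, update_idem]) x
  simpa [reset] using this

end LongestPathContractibility

/-! ### Evaluation of first-order formulas in polynomial time. -/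

namespace LongestPathContractibility

open Turing Function Prog

/-- First-order formulas with free variables in `X` over a graph on an initial segment of `ℕ`,
with the order of the vertices and a digest from `Fin 16` as additional structure. -/
inductive Fml : Type → Type 1
  | adj {X : Type} (a b : X) : Fml X
  | le {X : Type} (a b : X) : Fml X
  | digest {X : Type} (r : Fin 16) : Fml X
  | neg {X : Type} (φ : Fml X) : Fml X
  | and {X : Type} (φ ψ : Fml X) : Fml X
  | ex {X : Type} (φ : Fml (Option X)) : Fml X

namespace Fml

/-- The truth value of a formula. -/
def eval {n : ℕ} (G : SimpleGraph (Fin n)) (q : Fin 16) : {X : Type} → Fml X → (X → Fin n) → Prop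
  | _, adj a b, v => G.Adj (v a) (v b)
  | _, le a b, v => v a ≤ v b
  | _, digest r, _ => q = r
  | _, neg φ, v => ¬ φ.eval G q v
  | _, and φ ψ, v => φ.eval G q v ∧ ψ.eval G q v
  | _, ex φ, v => ∃ a, φ.eval G q (fun o => o.elim a v)

/-- The quantifier depth. -/
def depth : {X : Type} → Fml X → ℕ
  | _, adj _ _ | _, le _ _ | _, digest _ => 0
  | _, neg φ => φ.depth
  | _, and φ ψ => max φ.depth ψ.depth
  | _, ex φ => φ.depth + 1

/-- A bound for the number of steps needed to evaluate a formula. -/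
noncomputable def time : {X : Type} → Fml X → Polynomial ℕ
  | _, adj _ _ => 3 * Polynomial.X ^ 2 + 22 * Polynomial.X + 11
  | _, le _ _ => 20 * Polynomial.X + 11
  | _, digest _ => 1
  | _, neg φ => φ.time + 1
  | _, and φ ψ => φ.time + ψ.time + 2
  | _, ex φ => (Polynomial.X + 1) * (φ.time + 5) + 3 * Polynomial.X + 5

variable {M : ℕ}

/-- The program that evaluates a formula. The variable `x` is stored in the counters with index
`c x`, and the counters from `j` on are free. -/
def compile : {X : Type} → Fml X → (X → Fin (M + 1)) → ℕ → Prog (Stk M) Ctl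
  | _, adj a b, c, _ =>
      .seq (walk (c a) skipRow) (.seq (walk (c b) fwd)
        (.seq (.peek .mat fun v y => (decide (y = some (.bit true)), v.2)) rewind))
  | _, le a b, c, _ =>
      .seq (walk (c a) fwd) (.seq (walk (c b) back)
        (.seq (.peek .tmp fun v y => (y.isNone, v.2)) rewind))
  | _, digest r, _, _ => .load fun v => (decide (v.2.2 = r), v.2)
  | _, neg φ, c, j => .seq (φ.compile c j) (.load fun v => (!v.1, v.2))
  | _, and φ ψ, c, j => .seq (φ.compile c j) (.ite (fun v => v.1) (ψ.compile c j) (.load id))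
  | _, ex φ, c, j =>
      .seq (.peek (.todo (Fin.ofNat (M + 1) j)) fun v y => (false, y, v.2.2))
      (.seq (.loop (fun v => v.2.1.isSome && !v.1)
        (.seq (φ.compile (fun o => o.elim (Fin.ofNat (M + 1) j) c) (j + 1))
        (.seq (.ite (fun v => v.1) (.load id)
          (.seq (.pop (.todo (Fin.ofNat (M + 1) j)) keep)
            (.push (.done (Fin.ofNat (M + 1) j)) fun _ => .blank)))
        (.peek (.todo (Fin.ofNat (M + 1) j)) keep))))
      (reset (Fin.ofNat (M + 1) j)))

end Fml

/-- `A` is the adjacency matrix of `G`, the rows being closed by commas. -/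
structure IsMatrix {n : ℕ} (G : SimpleGraph (Fin n)) (A : List Γ') : Prop where
  length : A.length = n * (n + 1)
  bit : ∀ i j : Fin n, ∃ c, A[(i : ℕ) * (n + 1) + j]? = some (.bit c) ∧ (c = true ↔ G.Adj i j)
  comma : ∀ i : Fin n, A[(i : ℕ) * (n + 1) + n]? = some .comma

theorem IsMatrix.le_length {n : ℕ} {G : SimpleGraph (Fin n)} {A : List Γ'} (h : IsMatrix G A) :
    n ≤ A.length := by
  rw [h.length]; nlinarith

variable {M n : ℕ} {G : SimpleGraph (Fin n)} {A : List Γ'}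

theorem IsMatrix.runs_rows (hA : IsMatrix G A) (i : Fin (M + 1)) (b x q) (E D : Fin (M + 1) → ℕ)
    (hi : E i < n) :
    Runs (walk i skipRow) ((b, x, q), storeAt A 0 0 E D)
      ((b, none, q), storeAt A (E i * (n + 1)) 0 E D) (E i * (3 * n + 5 + 6) + 4) := by
  have := runs_walk i skipRow b x q (fun t => A.drop (t * (n + 1)))
    (fun t => (A.take (t * (n + 1))).reverse) E D (3 * n + 5) (by
      intro t ht x s E'
      refine ⟨some .comma, ?_⟩
      have h := runs_skipRow (A := A) (p := t * (n + 1)) (r := n)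
        (fun j hj => (hA.bit ⟨t, by omega⟩ ⟨j, hj⟩).imp fun _ h => h.1)
        (hA.comma ⟨t, by omega⟩) b x q s E' D
      have e : t * (n + 1) + n + 1 = (t + 1) * (n + 1) := by ring
      rw [e] at h
      exact h)
  simpa [storeAt] using this

theorem runs_forward (i : Fin (M + 1)) (p : ℕ) (b x q) (E D : Fin (M + 1) → ℕ)
    (hi : p + E i ≤ A.length) :
    Runs (walk i fwd) ((b, x, q), storeAt A p 0 E D)
      ((b, none, q), storeAt A (p + E i) 0 E D) (E i * 8 + 4) :=
  runs_walk i fwd b x q (fun t => A.drop (p + t)) (fun t => (A.take (p + t)).reverse) E D 2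
    fun t ht x s E' => ⟨_, runs_fwd (List.getElem?_eq_getElem (by omega)) b x q s E' D⟩

theorem runs_backward (i : Fin (M + 1)) (p : ℕ) (b x q) (E D : Fin (M + 1) → ℕ)
    (hp : p ≤ A.length) :
    Runs (walk i back) ((b, x, q), storeAt A p 0 E D)
      ((b, none, q), storeAt A (p - E i) 0 E D) (E i * 9 + 4) :=
  runs_walk i back b x q (fun t => A.drop (p - t)) (fun t => (A.take (p - t)).reverse) E D 3
    fun t _ x s E' => runs_back (by omega) b x q s E' D

namespace Fml

/-- The memory is left exactly as it was found and only the control state changes; so subformulas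
can be evaluated one after the other, and a quantifier can rerun its body for every vertex. Each
quantifier multiplies the time by at most the length of the matrix plus one, up to lower terms,
since there are no more vertices than matrix entries. -/
theorem runs_compile (hA : IsMatrix G A) (q : Fin 16) {X : Type} (φ : Fml X) :
    ∀ (v : X → Fin n) (c : X → Fin (M + 1)) (j : ℕ) (E : Fin (M + 1) → ℕ),
      (∀ x, E (c x) = v x) → (∀ x, (c x : ℕ) < j) → (∀ i : Fin (M + 1), j ≤ i → E i = 0) →
      j + φ.depth ≤ M + 1 → ∀ b x, ∃ b' x', (b' = true ↔ φ.eval G q v) ∧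
        Runs (φ.compile c j) ((b, x, q), storeAt A 0 0 E fun i => n - E i)
          ((b', x', q), storeAt A 0 0 E fun i => n - E i) (φ.time.eval A.length) := by
  induction φ with
  | adj a₁ a₂ =>
    intro v c j E hE _ _ _ b x
    have hn := hA.le_length
    have h1 : E (c a₁) < n := by rw [hE]; exact (v a₁).2
    have h2 : E (c a₂) < n := by rw [hE]; exact (v a₂).2
    obtain ⟨d, hd, hadj⟩ := hA.bit (v a₁) (v a₂)
    rw [← hE, ← hE] at hd
    have hlt := (List.getElem?_eq_some_iff.1 hd).1
    refine ⟨decide (d = true), none, by simpa [eval] using hadj, ?_⟩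
    refine ((hA.runs_rows (c a₁) b x q E _ h1).seq ((runs_forward (c a₂) _ b none q E _
      hlt.le).seq ((runs_peek (v' := (decide (d = true), none, q)) ?_).seq
      (runs_rewind hlt.le _ _ q 0 E _)))).mono ?_
    · simp [storeAt, store, List.head?_drop, hd]
    · simp only [time, Polynomial.eval_add, Polynomial.eval_mul, Polynomial.eval_pow,
        Polynomial.eval_X, Polynomial.eval_ofNat]
      have h3 : E (c a₁) * (3 * n + 5 + 6) ≤ A.length * (3 * A.length + 5 + 6) := by
        gcongr
        omega
      nlinarith
  | le a₁ a₂ =>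
    intro v c j E hE _ _ _ b x
    have hn := hA.le_length
    have h1 : E (c a₁) < n := by rw [hE]; exact (v a₁).2
    have h2 : E (c a₂) < n := by rw [hE]; exact (v a₂).2
    refine ⟨decide (E (c a₁) ≤ E (c a₂)), none, by simp [eval, hE], ?_⟩
    refine ((runs_forward (c a₁) 0 b x q E _ (by omega)).seq ((runs_backward (c a₂) _ b none q E _
      (by omega)).seq ((runs_peek (v' := (decide (E (c a₁) ≤ E (c a₂)), none, q)) ?_).seq
      (runs_rewind (by omega) _ _ q 0 E _)))).mono ?_
    -- The read part is empty at position `0` only, provided that the matrix is not empty.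
    · have h3 : A ≠ [] := by rintro rfl; simp at hn; omega
      simp only [storeAt, store, Prod.mk.injEq, and_true, Nat.zero_add]
      rw [Bool.eq_iff_iff]
      simp [List.take_eq_nil_iff, h3, Nat.sub_eq_zero_iff_le]
    · simp only [time, Polynomial.eval_add, Polynomial.eval_mul,
        Polynomial.eval_X, Polynomial.eval_ofNat]
      omega
  | digest r =>
    intro v c j E _ _ _ _ b x
    exact ⟨decide (q = r), x, by simp [eval], (runs_load rfl).mono (by simp [time])⟩
  | neg φ ih =>
    intro v c j E hE hc h0 hM b x
    obtain ⟨b', x', hb, h⟩ := ih v c j E hE hc h0 hM b x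
    refine ⟨!b', x', by simp [eval, ← hb], (h.seq (runs_load rfl)).mono ?_⟩
    simp [time]
  | and φ ψ ih ih' =>
    intro v c j E hE hc h0 hM b x
    simp only [depth] at hM
    obtain ⟨b', x', hb, h⟩ := ih v c j E hE hc h0 (by omega) b x
    cases b' with
    | false =>
      refine ⟨false, x', by simp [eval, ← hb], (h.seq (Runs.ite_false rfl (runs_load rfl))).mono ?_⟩
      simp [time]
    | true =>
      obtain ⟨b'', x'', hb', h'⟩ := ih' v c j E hE hc h0 (by omega) true x'
      refine ⟨b'', x'', by simp [eval, ← hb, hb'], (h.seq (Runs.ite_true rfl h')).mono ?_⟩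
      simp [time]; omega
  | ex φ ih =>
    intro v c j E hE hc h0 hM b x
    simp only [depth] at hM
    set i : Fin (M + 1) := Fin.ofNat (M + 1) j with hi
    -- The depth bound gives `j ≤ M`, so `Fin.ofNat` does not wrap around and the counter `i` is
    -- really a free one.
    have hij : (i : ℕ) = j := Nat.mod_eq_of_lt (by omega)
    have hEi : E i = 0 := h0 i hij.ge
    set T := φ.time.eval A.length
    -- `St a` is the memory while the quantified variable has the value `a`.
    set St : ℕ → Stk M → List Γ' := fun a => storeAt A 0 0 (update E i a)
      fun k => n - update E i a k with hSt
    have hhead : ∀ a, (St a (.todo i)).head? = if a < n then some Γ'.blank else none := by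
      intro a
      by_cases h : a < n
      · obtain ⟨r, hr⟩ : ∃ r, n - a = r + 1 := ⟨n - a - 1, by omega⟩
        simp [hSt, storeAt, store, h, hr, List.replicate_succ]
      · simp [hSt, storeAt, store, h, Nat.sub_eq_zero_of_le (Nat.not_lt.1 h)]
    have hnext : ∀ a y b, a < n → Runs (.seq (.pop (.todo i) keep)
        (.push (.done i) fun _ => .blank)) ((b, y, q), St a) ((b, some .blank, q), St (a + 1))
        2 := by
      intro a y b ha
      refine (runs_pop (v' := (b, some Γ'.blank, q))
        (m' := store (A.drop 0) (A.take 0).reverse 0 (update E i a)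
          fun k => n - update E i (a + 1) k) ?_ ?_).seq (runs_push ?_)
      · rw [hhead, if_pos ha]; rfl
      · have e : (St a (.todo i)).tail = List.replicate (n - (a + 1)) Γ'.blank := by
          simp [hSt, storeAt, store, List.tail_replicate, Nat.sub_sub]
        rw [e]
        refine (update_store_todo _ _ _ _ _ _ _).trans ?_
        congr 1
        funext k
        by_cases hk : k = i
        · subst hk; simp
        · simp [hk]
      · have e : ∀ D, Γ'.blank :: store (A.drop 0) (A.take 0).reverse 0 (update E i a) D (.done i) =
            List.replicate (a + 1) Γ'.blank := by
          simp [store, List.replicate_succ]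
        rw [e, update_store_done, update_idem]
        rfl
    -- The search for a witness from `a` upwards, with `r` candidates left. It stops at the first
    -- witness, so the final value `a'` of the variable is not known in advance and `reset` has to
    -- cope with any `a' ≤ n`.
    have key : ∀ r a, a + r = n → ∃ b' x' a', (b' = true ↔ ∃ w : Fin n, a ≤ w ∧
          φ.eval G q (fun o => o.elim w v)) ∧ a' ≤ n ∧
        Runs (.loop (fun v => v.2.1.isSome && !v.1)
          (.seq (φ.compile (fun o => o.elim i c) (j + 1))
          (.seq (.ite (fun v => v.1) (.load id) (.seq (.pop (.todo i) keep)
            (.push (.done i) fun _ => .blank))) (.peek (.todo i) keep))))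
          ((false, (if a < n then some .blank else none), q), St a) ((b', x', q), St a')
          (r * (T + 5) + T + 6) := by
      intro r
      induction r with
      | zero =>
        intro a ha
        refine ⟨false, none, a, ?_, by omega, ?_⟩
        · simp only [Bool.false_eq_true, false_iff, not_exists, not_and]
          intro w hw; omega
        · rw [if_neg (by omega)]
          exact (Runs.loop_false rfl).mono (by omega)
      | succ r ihr =>
        intro a ha
        have han : a < n := by omega
        rw [if_pos han]
        obtain ⟨b', x', hb, h⟩ := ih (fun o => o.elim ⟨a, han⟩ v) (fun o => o.elim i c) (j + 1)
          (update E i a) (by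
            rintro (_ | y)
            · simp
            · have : c y ≠ i := by
                intro h; have := hc y; rw [h] at this; omega
              simp [this, hE]) (by
            rintro (_ | y)
            · simp [hij]
            · exact (hc y).trans (Nat.lt_succ_self j)) (by
            intro k hk
            have : k ≠ i := by rintro rfl; omega
            simp only [update_of_ne this]
            exact h0 k (by omega)) (by omega) false (some .blank)
        cases b' with
        | true =>
          refine ⟨true, some .blank, a, ?_, han.le, ?_⟩
          · simp only [true_iff]
            exact ⟨⟨a, han⟩, le_rfl, hb.1 rfl⟩
          · refine (Runs.loop_true (c := fun v => v.2.1.isSome && !v.1) rfl (h.seq ((Runs.ite_true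
              (c := fun v => v.1) rfl (runs_load rfl)).seq
              (runs_peek (v' := (true, some .blank, q)) ?_)))
              (Runs.loop_false (by rfl))).mono ?_
            · change keep _ (St a (.todo i)).head? = _
              rw [hhead, if_pos han]; rfl
            · have : 0 ≤ r * (T + 5) := by positivity
              have : (r + 1) * (T + 5) = r * (T + 5) + T + 5 := by ring
              omega
        | false =>
          obtain ⟨b', x', a', hb', ha', h'⟩ := ihr (a + 1) (by omega)
          refine ⟨b', x', a', ?_, ha', ?_⟩
          · rw [hb']
            constructor
            · rintro ⟨w, hw, hφ⟩
              exact ⟨w, by omega, hφ⟩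
            · rintro ⟨w, hw, hφ⟩
              refine ⟨w, ?_, hφ⟩
              rcases Nat.lt_or_eq_of_le hw with hw | hw
              · exact hw
              · have : w = ⟨a, han⟩ := Fin.ext hw.symm
                subst this
                exact absurd (hb.2 hφ) (by simp)
          · refine (Runs.loop_true (c := fun v => v.2.1.isSome && !v.1) rfl (h.seq ((Runs.ite_false
              (c := fun v => v.1) rfl (hnext a _ false han)).seq
              (runs_peek (v' := (false, (if a + 1 < n then some .blank else none), q)) ?_)))
              h').mono ?_
            · rw [hhead]; rfl
            · have : (r + 1) * (T + 5) = r * (T + 5) + T + 5 := by ring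
              omega
    obtain ⟨b', x', a', hb', ha', h'⟩ := key n 0 (by omega)
    refine ⟨b', none, ?_, ?_⟩
    · rw [hb']; simp [eval]
    · have e0 : (storeAt A 0 0 E fun k => n - E k) = St 0 := by
        simp only [hSt]
        rw [← hEi, update_eq_self]
      have hr : Runs (reset i) ((b', x', q), St a') ((b', none, q), St 0) (a' * 3 + 2) := by
        have := runs_reset i b' x' q (A.drop 0) (A.take 0).reverse 0 (update E i a')
          fun k => n - update E i a' k
        simp only [update_self, update_idem, Nat.sub_add_cancel ha'] at this
        have e : update (fun k => n - update E i a' k) i n = fun k => n - update E i 0 k := by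
          funext k
          by_cases hk : k = i
          · subst hk; simp
          · simp [hk]
        rw [e] at this
        exact this
      rw [e0]
      refine ((runs_peek ?_).seq (h'.seq hr)).mono ?_
      · rw [hhead]
      · simp only [time, Polynomial.eval_add, Polynomial.eval_mul,
          Polynomial.eval_X, Polynomial.eval_ofNat, Polynomial.eval_one]
        have hn := hA.le_length
        have : n * (T + 5) ≤ A.length * (T + 5) := Nat.mul_le_mul_right _ hn
        have e : (A.length + 1) * (T + 5) = A.length * (T + 5) + T + 5 := by ring
        change _ ≤ (A.length + 1) * (T + 5) + 3 * A.length + 5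
        omega

end Fml

end LongestPathContractibility

/-! ### Reading the input word: matrix entries, the digest of `k`, counters, and cleaning up. -/

namespace LongestPathContractibility

open Turing Function Prog

theorem getElem?_flatMap_of_length {α β : Type*} (f : α → List β) (w : ℕ) :
    ∀ (l : List α), (∀ a ∈ l, (f a).length = w) → ∀ i j, j < w →
      (l.flatMap f)[i * w + j]? = l[i]?.bind fun a => (f a)[j]?
  | [], _, i, j, _ => by simp
  | a :: l, h, i, j, hj => by
    have ha : (f a).length = w := h a (by simp)
    cases i with
    | zero => simp [List.getElem?_append_left, ha, hj]
    | succ i =>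
      have e : (i + 1) * w + j = w + (i * w + j) := by ring
      rw [List.flatMap_cons, List.getElem?_append_right (by rw [ha, e]; omega), ha, e,
        Nat.add_sub_cancel_left,
        getElem?_flatMap_of_length f w l (fun b hb => h b (by simp [hb])) i j hj]
      simp

theorem isMatrix_encodeGraph {n : ℕ} (G : SimpleGraph (Fin n)) : IsMatrix G (encodeGraph G) := by
  classical
  have hlen : ∀ i ∈ List.finRange n, ((List.finRange n).map
      (fun j => Γ'.bit (decide (G.Adj i j))) ++ [Γ'.comma]).length = n + 1 := by simp
  refine ⟨by simp [encodeGraph], fun i j => ⟨decide (G.Adj i j), ?_, by simp⟩, fun i => ?_⟩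
  · have := getElem?_flatMap_of_length _ (n + 1) (List.finRange n) hlen i j (by omega)
    simp only [encodeGraph]
    convert this using 1
    simp
  · have := getElem?_flatMap_of_length _ (n + 1) (List.finRange n) hlen i n (by omega)
    simp only [encodeGraph]
    convert this using 1
    simp

/-- Update the digest of a binary number by one more bit: the digest is the word of bits itself,
with a leading one, as long as the word has at most three letters, and zero afterwards. -/
def digestStep (q : Fin 16) (b : Bool) : Fin 16 :=
  if q = 0 then 0 else if h : (q : ℕ) < 8 then ⟨2 * q + b.toNat, by cases b <;> simp <;> omega⟩ else 0

/-- The digest of a number. -/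
def digest (k : ℕ) : Fin 16 := (encodeNat k).foldl digestStep 1

variable {M n : ℕ} {G : SimpleGraph (Fin n)} {A : List Γ'}

/-- Is the last symbol read a bit? -/
def isBit (v : Ctl) : Bool :=
  match v.2.1 with
  | some (.bit _) => true
  | _ => false

/-- The value of the last bit read. -/
def bitVal (v : Ctl) : Bool := decide (v.2.1 = some (.bit true))

/-- Read a binary number into the digest. -/
def readNum : Prog (Stk M) Ctl :=
  .seq (.pop .mat keep)
    (.loop isBit (.seq (.load fun v => (v.1, v.2.1, digestStep v.2.2 (bitVal v))) (.pop .mat keep)))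

theorem runs_readNum (l : List Bool) (b x q) (R T s) (E D : Fin (M + 1) → ℕ) :
    Runs readNum ((b, x, q), store (l.map Γ'.bit ++ Γ'.comma :: R) T s E D)
      ((b, some .comma, l.foldl digestStep q), store R T s E D) (3 * l.length + 2) := by
  have hpop : ∀ y (A' : List Γ') x q, Runs (.pop .mat keep) ((b, x, q), store (M := M) (y :: A') T s E D)
      ((b, some y, q), store A' T s E D) 1 := fun y A' x q =>
    runs_pop rfl (update_store_mat _ _ _ _ _ _)
  have key : ∀ (l : List Bool) q y A', l.map Γ'.bit ++ Γ'.comma :: R = y :: A' →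
      Runs (.loop isBit (.seq
        (.load fun v => (v.1, v.2.1, digestStep v.2.2 (bitVal v))) (.pop .mat keep)))
      ((b, some y, q), store (M := M) A' T s E D)
      ((b, some .comma, l.foldl digestStep q), store R T s E D) (3 * l.length + 1) := by
    intro l
    induction l with
    | nil =>
      intro q y A' h
      obtain ⟨rfl, rfl⟩ := List.cons.inj h
      exact Runs.loop_false rfl
    | cons c l ih =>
      intro q y A' h
      obtain ⟨rfl, h'⟩ := List.cons.inj h
      obtain ⟨y, A'', e⟩ : ∃ y A'', A' = y :: A'' := by
        rw [← h']; cases l <;> simp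
      subst e
      refine (Runs.loop_true (c := isBit) rfl ((runs_load
        (v' := (b, some (.bit c), digestStep q c)) ?_).seq (hpop y A'' _ _)) (ih _ y A'' h')).mono ?_
      · cases c <;> rfl
      · simp; omega
  obtain ⟨y, A', e⟩ : ∃ y A', l.map Γ'.bit ++ Γ'.comma :: R = y :: A' := by
    cases l <;> simp
  rw [e]
  exact ((hpop y A' x q).seq (key l q y A' e)).mono (by omega)

/-- Increase the second counters of the variables in the list `l`. -/
def pushAll : List (Fin (M + 1)) → Prog (Stk M) Ctl
  | [] => .load id
  | i :: l => .seq (.push (.todo i) fun _ => .blank) (pushAll l)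

theorem runs_pushAll (A T s) (E : Fin (M + 1) → ℕ) (v : Ctl) :
    ∀ (l : List (Fin (M + 1))) (D : Fin (M + 1) → ℕ),
      Runs (pushAll l) (v, store A T s E D) (v, store A T s E fun i => D i + l.count i)
        (l.length + 1)
  | [], D => runs_load rfl
  | i :: l, D => by
    have h := runs_pushAll A T s E v l (update D i (D i + 1))
    have e : (fun k => update D i (D i + 1) k + l.count k) =
        fun k => D k + (i :: l).count k := by
      funext k
      by_cases hk : k = i
      · subst hk; simp; omega
      · simp [hk, List.count_cons_of_ne (Ne.symm hk)]
    rw [e] at h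
    refine ((runs_push ?_).seq h).mono (by simp; omega)
    exact update_store_todo _ _ _ (D i + 1) _ _ _

/-- Set the second counters of all variables to the length of the first row of the matrix. -/
def initCounters : Prog (Stk M) Ctl :=
  .seq (.seq (.peek .mat keep)
    (.loop isBit (.seq fwd (.seq (pushAll (List.finRange (M + 1))) (.peek .mat keep))))) rewind

theorem runs_initCounters (hA : IsMatrix G A) (hn : 0 < n) (b x q) :
    Runs initCounters ((b, x, q), storeAt A 0 0 (fun _ : Fin (M + 1) => 0) fun _ => 0)
      ((b, none, q), storeAt A 0 0 (fun _ => 0) fun _ => n) ((M + 9) * A.length + 4) := by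
  have hlen := hA.le_length
  have h0 : ∀ r p D, p + r = n → ∀ y, A[p]? = some y →
      Runs (.loop isBit (.seq fwd (.seq (pushAll (List.finRange (M + 1))) (.peek .mat keep))))
      ((b, some y, q), storeAt A p 0 (fun _ : Fin (M + 1) => 0) fun _ => D)
      ((b, some .comma, q), storeAt A n 0 (fun _ => 0) fun _ => D + r) (r * (M + 6) + 1) := by
    intro r
    induction r with
    | zero =>
      intro p D hp y hy
      have e : p = n := hp
      subst e
      have := hA.comma ⟨0, hn⟩
      simp only [Nat.zero_mul, Nat.zero_add] at this
      have e : y = .comma := by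
        have := hy.symm.trans this
        simpa using this
      subst e
      exact (Runs.loop_false rfl).mono (by omega)
    | succ r ih =>
      intro p D hp y hy
      obtain ⟨c, hc, _⟩ := hA.bit ⟨0, hn⟩ ⟨p, by omega⟩
      simp only [Nat.zero_mul, Nat.zero_add] at hc
      have e : y = .bit c := by
        have := hy.symm.trans hc
        simpa using this
      subst e
      have hp1 : p + 1 < A.length := by rw [hA.length]; nlinarith
      have hcount : (fun i : Fin (M + 1) => D + (List.finRange (M + 1)).count i) =
          fun _ => D + 1 := by
        funext i
        rw [List.count_eq_one_of_mem (List.nodup_finRange _) (List.mem_finRange i)]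
      have h1 := runs_pushAll (A.drop (p + 1)) (A.take (p + 1)).reverse 0
        (fun _ : Fin (M + 1) => 0) (b, some (.bit c), q) (List.finRange (M + 1)) fun _ => D
      rw [hcount] at h1
      have h2 := ih (p + 1) (D + 1) (by omega) A[p + 1] (List.getElem?_eq_getElem hp1)
      have e : D + 1 + r = D + (r + 1) := by omega
      rw [e] at h2
      refine (Runs.loop_true rfl ((runs_fwd hc b _ q 0 _ _).seq (h1.seq (runs_peek ?_)))
        h2).mono ?_
      · simp [keep, store, List.head?_drop, List.getElem?_eq_getElem hp1]
      · rw [List.length_finRange, Nat.succ_mul]; omega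
  obtain ⟨c, hc, _⟩ := hA.bit ⟨0, hn⟩ ⟨0, hn⟩
  have h1 := h0 n 0 0 (by omega) (.bit c) (by simpa using hc)
  rw [Nat.zero_add] at h1
  refine (((runs_peek ?_).seq h1).seq (runs_rewind hlen b _ q 0 _ _)).mono ?_
  · simp only [Nat.zero_mul, Nat.zero_add] at hc
    simp [keep, storeAt, store, List.head?_eq_getElem?, hc]
  · have : n * (M + 6) + n * 3 ≤ (M + 9) * A.length := by nlinarith
    omega

/-- Empty the stack `a`. -/
def drain (a : Stk M) : Prog (Stk M) Ctl := forPop a (.load id)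

theorem runs_drain (a : Stk M) (b x q) (m : Stk M → List Γ') :
    Runs (drain a) ((b, x, q), m) ((b, none, q), update m a []) ((m a).length * 3 + 2) := by
  have := runs_forPop a (.load id) b q (m a).length 1 (fun t => update m a ((m a).drop t))
    (by simp) (by
      intro t ht
      refine ⟨(m a)[t], by simp [List.head?_drop, ht], some (m a)[t], ?_⟩
      simpa using runs_load (f := id) (id_eq _)) x
  simpa [drain] using this

/-- Empty the second counters of the variables in the list `l`. -/
def drainAll : List (Fin (M + 1)) → Prog (Stk M) Ctl
  | [] => .load id
  | i :: l => .seq (drain (.todo i)) (drainAll l)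

theorem runs_drainAll (A T s) (E : Fin (M + 1) → ℕ) (b q) :
    ∀ (l : List (Fin (M + 1))) (D : Fin (M + 1) → ℕ), (∀ i, D i ≤ n) → ∀ x, ∃ x',
      Runs (drainAll l) ((b, x, q), store A T s E D)
        ((b, x', q), store A T s E fun i => if i ∈ l then 0 else D i)
        (l.length * (n * 3 + 2) + 1)
  | [], D, _, x => ⟨x, by simpa [drainAll] using runs_load (f := id) (id_eq _)⟩
  | i :: l, D, hD, x => by
    obtain ⟨x', h⟩ := runs_drainAll A T s E b q l (update D i 0) (by
      intro k
      by_cases hk : k = i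
      · subst hk; simp
      · simpa [hk] using hD k) none
    have e : (fun k => if k ∈ l then 0 else update D i 0 k) =
        fun k => if k ∈ i :: l then 0 else D k := by
      funext k
      by_cases hk : k = i
      · subst hk; simp
      · simp [hk]
    rw [e] at h
    have h1 := runs_drain (.todo i) b x q (store A T s E D)
    have e1 : update (store A T s E D) (.todo i) [] = store A T s E (update D i 0) :=
      update_store_todo _ _ _ 0 _ _ _
    rw [e1] at h1
    refine ⟨x', (h1.seq h).mono ?_⟩
    have : (store A T s E D (.todo i)).length ≤ n := by simpa [store] using hD i
    rw [List.length_cons, Nat.succ_mul]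
    omega

theorem eval_le_eval (p : Polynomial ℕ) {a b : ℕ} (h : a ≤ b) : p.eval a ≤ p.eval b := by
  rw [Polynomial.eval_eq_sum, Polynomial.eval_eq_sum]
  exact Finset.sum_le_sum fun i _ => Nat.mul_le_mul_left _ (Nat.pow_le_pow_left h i)

/-- Properties of instances defined by a formula are decidable in polynomial time. -/
theorem polyTime_of_fml {W : Type} (H : SimpleGraph W) (φ : Fml Empty) (f : Instance H → Bool)
    (hf : ∀ I : Instance H, f I = true ↔ φ.eval I.G (digest I.k) Empty.elim) :
    Nonempty (TM2ComputableInPolyTime (Instance.encode (H := H)) encodeBool f) := by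
  classical
  set M := φ.depth
  -- Nested quantifiers need at most `φ.depth` counters at a time. The digest starts at `1`, which
  -- stands for the empty word. At the end only the matrix and the second counters are drained, as
  -- all other stacks are then empty already.
  refine polyTime_of_exec (S := Stk M) (σ := Ctl) _ f
    (.seq readNum (.seq initCounters (.seq (φ.compile Empty.elim 0)
      (.seq (drain .mat) (drainAll (List.finRange (M + 1)))))))
    .mat (false, none, 1) (fun v => v.1)
    (φ.time + Polynomial.C (4 * M + 18) * Polynomial.X + Polynomial.C (2 * M + 11)) fun I => ?_
  have hA := isMatrix_encodeGraph I.G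
  have hn : 0 < I.n := by
    obtain ⟨v⟩ := I.connected.nonempty
    exact v.pos
  set A := encodeGraph I.G with hAdef
  have hle : A.length ≤ I.encode.length := by simp [Instance.encode, ← hAdef]; omega
  have hle' : (encodeNat I.k).length ≤ I.encode.length := by simp [Instance.encode]
  have hnl := hA.le_length
  have h1 := runs_readNum (M := M) (encodeNat I.k) false none 1 A [] 0 (fun _ => 0) (fun _ => 0)
  have h2 := runs_initCounters (M := M) hA hn false (some .comma) (digest I.k)
  obtain ⟨b, x, hb, h3⟩ := φ.runs_compile (M := M) hA (digest I.k) Empty.elim Empty.elim 0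
    (fun _ => 0) (fun x => x.elim) (fun x => x.elim) (fun _ _ => rfl) (by omega) false none
  have h4 := runs_drain (M := M) .mat b x (digest I.k) (storeAt A 0 0 (fun _ => 0) fun _ => I.n)
  obtain ⟨x', h5⟩ := runs_drainAll (M := M) (n := I.n) [] [] 0 (fun _ => 0) b (digest I.k)
    (List.finRange (M + 1)) (fun _ => I.n) (fun _ => le_rfl) none
  have e4 : update (storeAt (M := M) A 0 0 (fun _ => 0) fun _ => I.n) .mat [] =
      store [] [] 0 (fun _ => 0) fun _ => I.n := by
    simp [storeAt, update_store_mat]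
  rw [e4] at h4
  obtain ⟨t, ht, h⟩ := h1.seq (h2.seq (h3.seq (h4.seq h5)))
  refine ⟨(b, x', digest I.k), t, ?_, ?_, ?_⟩
  · refine ht.trans ?_
    have e : (storeAt A 0 0 (fun _ : Fin (M + 1) => 0) (fun _ => I.n) Stk.mat).length =
        A.length := by simp [storeAt, store]
    rw [e, List.length_finRange]
    have h6 := eval_le_eval φ.time hle
    simp only [Polynomial.eval_add, Polynomial.eval_mul, Polynomial.eval_C, Polynomial.eval_X]
    generalize Polynomial.eval A.length φ.time = t1 at *
    generalize Polynomial.eval I.encode.length φ.time = t2 at *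
    generalize I.encode.length = L at *
    generalize (encodeNat I.k).length = l at *
    generalize A.length = a at *
    have h7 : (M + 9) * a ≤ (M + 9) * L := Nat.mul_le_mul_left _ hle
    have h8 : (M + 1) * (I.n * 3 + 2) ≤ (M + 1) * (L * 3 + 2) := by gcongr; omega
    nlinarith
  · rw [Bool.eq_iff_iff, hf, hb]
  · convert h using 2
    · funext k
      cases k <;> simp [store, Instance.encode, update, ← hAdef]
    · funext k
      cases k <;> simp [store]

end LongestPathContractibility

/-! ### First-order definability of sets of vertices and of path contractions. -/

namespace LongestPathContractibility

open Function

section Graph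

variable {V : Type*} (G : SimpleGraph V)

/-- The vertices with a neighbour in `s`. -/
def nbr (s : Set V) : Set V := {v | ∃ a ∈ s, G.Adj a v}

/-- The vertices that can be reached from `B` by at most `n` steps within `R`. -/
def ball (R B : Set V) : ℕ → Set V
  | 0 => B
  | n + 1 => ball R B n ∪ nbr G (ball R B n) ∩ R

/-- The sets `L i` are the bags of a contraction to a path. The connectedness of the bags is
witnessed by short paths. -/
structure IsBags {k : ℕ} (L : Fin k → Set V) : Prop where
  cover : ∀ v, ∃ i, v ∈ L i
  nonempty : ∀ i, ∃ v, v ∈ L i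
  disjoint : ∀ i j, i < j → ∀ v, v ∈ L i → v ∉ L j
  far : ∀ i j : Fin k, (i : ℕ) + 1 < j → ∀ v, v ∈ nbr G (L i) → v ∉ L j
  conn : ∀ i, ∀ u, u ∈ L i → ∀ v, v ∈ L i → v ∈ ball G (L i) {u} 5

end Graph

namespace Fml

/-- Substitution of variables for the free variables. -/
def rename : {X Y : Type} → (X → Y) → Fml X → Fml Y
  | _, _, f, adj a b => adj (f a) (f b)
  | _, _, f, le a b => le (f a) (f b)
  | _, _, _, digest r => digest r
  | _, _, f, neg φ => neg (φ.rename f)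
  | _, _, f, and φ ψ => and (φ.rename f) (ψ.rename f)
  | _, _, f, ex φ => ex (φ.rename (Option.map f))

theorem eval_rename {n : ℕ} (G : SimpleGraph (Fin n)) (q : Fin 16) {X : Type} (φ : Fml X) :
    ∀ {Y : Type} (f : X → Y) (v : Y → Fin n),
      (φ.rename f).eval G q v ↔ φ.eval G q (fun x => v (f x)) := by
  induction φ with
  | adj | le | digest => intros; rfl
  | neg φ ih => intro Y f v; simp only [rename, eval, ih]
  | and φ ψ ih ih' => intro Y f v; simp only [rename, eval, ih, ih']
  | ex φ ih =>
    intro Y f v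
    simp only [rename, eval, ih]
    refine exists_congr fun a => ?_
    have e : (fun o => Option.elim (Option.map f o) a v) =
        fun o => Option.elim o a fun x => v (f x) := by
      funext o; cases o <;> rfl
    rw [e]

end Fml

variable {W : Type} {H : SimpleGraph W}

/-- A property of instances, depending on some vertices, is definable by a formula. -/
def Definable {X : Type} (P : ∀ I : Instance H, (X → Fin I.n) → Prop) : Prop :=
  ∃ φ : Fml X, ∀ I v, φ.eval I.G (digest I.k) v ↔ P I v

/-- A set of vertices, depending on some vertices, is definable by a formula. -/
def DefinableSet {X : Type} (S : ∀ I : Instance H, (X → Fin I.n) → Set (Fin I.n)) : Prop :=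
  Definable (X := Option X) fun I w => w none ∈ S I fun x => w (some x)

namespace Definable

variable {X Y : Type} {P Q : ∀ I : Instance H, (X → Fin I.n) → Prop}

theorem congr (h : Definable P) (e : ∀ I v, P I v ↔ Q I v) : Definable Q := by
  obtain ⟨φ, h⟩ := h
  exact ⟨φ, fun I v => (h I v).trans (e I v)⟩

theorem rename (h : Definable P) (f : X → Y) : Definable fun I (v : Y → Fin I.n) =>
    P I fun x => v (f x) := by
  obtain ⟨φ, h⟩ := h
  exact ⟨φ.rename f, fun I v => (φ.eval_rename _ _ f v).trans (h I _)⟩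

theorem not (h : Definable P) : Definable fun I v => ¬ P I v := by
  obtain ⟨φ, h⟩ := h
  exact ⟨φ.neg, fun I v => not_congr (h I v)⟩

theorem and (h : Definable P) (h' : Definable Q) : Definable fun I v => P I v ∧ Q I v := by
  obtain ⟨φ, h⟩ := h
  obtain ⟨ψ, h'⟩ := h'
  exact ⟨φ.and ψ, fun I v => and_congr (h I v) (h' I v)⟩

theorem or (h : Definable P) (h' : Definable Q) : Definable fun I v => P I v ∨ Q I v :=
  (h.not.and h'.not).not.congr fun I v => by tauto

theorem imp (h : Definable P) (h' : Definable Q) : Definable fun I v => P I v → Q I v :=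
  (h.not.or h').congr fun I v => by tauto

theorem exists_vertex {P : ∀ I : Instance H, (X → Fin I.n) → Fin I.n → Prop}
    (h : Definable fun I (w : Option X → Fin I.n) => P I (fun x => w (some x)) (w none)) :
    Definable fun I v => ∃ a, P I v a := by
  obtain ⟨φ, h⟩ := h
  exact ⟨φ.ex, fun I v => exists_congr fun a => h I _⟩

theorem forall_vertex {P : ∀ I : Instance H, (X → Fin I.n) → Fin I.n → Prop}
    (h : Definable fun I (w : Option X → Fin I.n) => P I (fun x => w (some x)) (w none)) :
    Definable fun I v => ∀ a, P I v a :=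
  (exists_vertex (P := fun I v a => ¬ P I v a) h.not).not.congr fun I v => by simp

theorem adj (a b : X) : Definable (H := H) fun I v => I.G.Adj (v a) (v b) :=
  ⟨.adj a b, fun _ _ => Iff.rfl⟩

theorem eq (a b : X) : Definable (H := H) fun _ v => v a = v b :=
  ⟨.and (.le a b) (.le b a), fun _ _ => le_antisymm_iff.symm⟩

theorem digest_eq (r : Fin 16) : Definable (H := H) (X := X) fun I _ => digest I.k = r :=
  ⟨.digest r, fun _ _ => Iff.rfl⟩

theorem true_of (h : Definable P) : Definable (H := H) (X := X) fun _ _ => True :=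
  (h.imp h).congr fun I v => by tauto

theorem forall_fin {k : ℕ} {P : Fin k → ∀ I : Instance H, (X → Fin I.n) → Prop}
    (h : ∀ i, Definable (P i)) : Definable fun I v => ∀ i, P i I v := by
  induction k with
  | zero => exact (true_of (digest_eq (H := H) 0)).congr fun I v => by simp
  | succ k ih =>
    exact ((h 0).and (ih fun i => h i.succ)).congr fun I v => by rw [Fin.forall_fin_succ]

theorem exists_fin {k : ℕ} {P : Fin k → ∀ I : Instance H, (X → Fin I.n) → Prop}
    (h : ∀ i, Definable (P i)) : Definable fun I v => ∃ i, P i I v :=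
  (forall_fin fun i => (h i).not).not.congr fun I v => by simp

theorem imp_of {p : Prop} (h : Definable P) : Definable fun I v => p → P I v := by
  by_cases hp : p
  · exact h.congr fun I v => by simp [hp]
  · exact h.true_of.congr fun I v => by simp [hp]

theorem exists_tuple {d : ℕ} {P : ∀ I : Instance H, (Fin d → Fin I.n) → Prop} (h : Definable P) :
    Definable fun I (_ : Empty → Fin I.n) => ∃ v, P I v := by
  induction d with
  | zero =>
    refine (h.rename Fin.elim0).congr fun I v => ?_
    rw [Unique.exists_iff]
    exact iff_of_eq (congrArg _ (Subsingleton.elim _ _))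
  | succ d ih =>
    have h1 := h.rename (Y := Option (Fin d)) (Fin.cons none some)
    have h2 : Definable fun I (w : Option (Fin d) → Fin I.n) =>
        P I (Fin.cons (w none) fun x => w (some x)) := by
      refine h1.congr fun I w => iff_of_eq (congrArg _ ?_)
      funext i
      refine Fin.cases rfl (fun i => rfl) i
    refine (ih (exists_vertex (P := fun I v a => P I (Fin.cons a v)) h2)).congr fun I v => ?_
    rw [Fin.exists_fin_succ_pi]
    exact exists_comm

end Definable

namespace DefinableSet

variable {X : Type} {S T : ∀ I : Instance H, (X → Fin I.n) → Set (Fin I.n)}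

theorem compl (h : DefinableSet S) : DefinableSet fun I v => (S I v)ᶜ :=
  h.not

theorem inter (h : DefinableSet S) (h' : DefinableSet T) : DefinableSet fun I v => S I v ∩ T I v :=
  h.and h'

theorem union (h : DefinableSet S) (h' : DefinableSet T) : DefinableSet fun I v => S I v ∪ T I v :=
  h.or h'

theorem sdiff (h : DefinableSet S) (h' : DefinableSet T) : DefinableSet fun I v => S I v \ T I v :=
  h.and h'.not

theorem singleton (a : X) : DefinableSet (H := H) fun _ v => {v a} :=
  Definable.eq none (some a)

theorem univ : DefinableSet (H := H) (X := X) fun _ _ => Set.univ :=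
  (Definable.eq none none).congr fun _ _ => by simp

theorem weaken (h : DefinableSet S) :
    DefinableSet fun I (w : Option X → Fin I.n) => S I fun x => w (some x) :=
  h.rename (Y := Option (Option X)) (Option.map some)

theorem nbr (h : DefinableSet S) : DefinableSet fun I v => nbr I.G (S I v) :=
  Definable.exists_vertex (P := fun I w a => a ∈ S I (fun x => w (some x)) ∧ I.G.Adj a (w none))
    (h.weaken.and (Definable.adj none (some none)))

theorem ball (h : DefinableSet S) (h' : DefinableSet T) (n : ℕ) :
    DefinableSet fun I v => ball I.G (S I v) (T I v) n := by
  induction n with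
  | zero => exact h'
  | succ n ih => exact ih.union (ih.nbr.inter h)

/-- All conditions quantify over vertices and over a fixed finite index set only; connectedness has
been replaced by balls of the fixed radius `5` for this purpose. -/
theorem _root_.LongestPathContractibility.Definable.isBags {k : ℕ}
    {L : Fin k → ∀ I : Instance H, (X → Fin I.n) → Set (Fin I.n)} (h : ∀ i, DefinableSet (L i)) :
    Definable fun I v => IsBags I.G fun i => L i I v := by
  have h1 : Definable fun I v => ∀ a, ∃ i, a ∈ L i I v :=
    .forall_vertex (P := fun I v a => ∃ i, a ∈ L i I v) (.exists_fin h)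
  have h2 : Definable fun I v => ∀ i, ∃ a, a ∈ L i I v :=
    .forall_fin fun i => .exists_vertex (P := fun I v a => a ∈ L i I v) (h i)
  have h3 : Definable fun I v => ∀ i j, i < j → ∀ a, a ∈ L i I v → a ∉ L j I v :=
    .forall_fin fun i => .forall_fin fun j => .imp_of
      (.forall_vertex (P := fun I v a => a ∈ L i I v → a ∉ L j I v) ((h i).imp (h j).not))
  have h4 : Definable fun I v => ∀ i j : Fin k, (i : ℕ) + 1 < j →
      ∀ a, a ∈ LongestPathContractibility.nbr I.G (L i I v) → a ∉ L j I v :=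
    .forall_fin fun i => .forall_fin fun j => .imp_of
      (.forall_vertex (P := fun I v a => a ∈ LongestPathContractibility.nbr I.G (L i I v) →
        a ∉ L j I v) ((h i).nbr.imp (h j).not))
  have h5 : Definable fun I v => ∀ i, ∀ u, u ∈ L i I v → ∀ a, a ∈ L i I v →
      a ∈ LongestPathContractibility.ball I.G (L i I v) {u} 5 :=
    .forall_fin fun i => .forall_vertex (P := fun I v u => u ∈ L i I v → ∀ a, a ∈ L i I v →
      a ∈ LongestPathContractibility.ball I.G (L i I v) {u} 5)
      (Definable.imp (h i) (.forall_vertex (P := fun I w a => a ∈ L i I (fun x => w (some x)) →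
        a ∈ LongestPathContractibility.ball I.G (L i I fun x => w (some x)) {w none} 5)
        ((h i).weaken.imp ((h i).weaken.ball (singleton none) 5))))
  exact (h1.and (h2.and (h3.and (h4.and h5)))).congr fun I v =>
    ⟨fun h => ⟨h.1, h.2.1, h.2.2.1, h.2.2.2.1, h.2.2.2.2⟩, fun h => ⟨h.1, h.2, h.3, h.4, h.5⟩⟩

end DefinableSet

end LongestPathContractibility

/-! ### Connected sets, and short paths in `(P₁ + P₅)`-free graphs. -/

namespace LongestPathContractibility

open Function

section Connectivity

variable {V : Type*} {G : SimpleGraph V}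

/-- `s` induces a connected (or empty) subgraph: a property that is preserved along the edges inside
`s` and that holds for one vertex of `s` holds for all of them. -/
def Conn (G : SimpleGraph V) (s : Set V) : Prop :=
  ∀ P : V → Prop, (∀ a ∈ s, ∀ b ∈ s, G.Adj a b → P a → P b) → ∀ u ∈ s, ∀ v ∈ s, P u → P v

theorem conn_univ_of_connected (h : G.Connected) : Conn G Set.univ := by
  intro P hP u _ v _ hu
  have h1 := (SimpleGraph.reachable_iff_reflTransGen u v).1 (h.preconnected u v)
  induction h1 with
  | refl => exact hu
  | tail _ hab ih => exact hP _ trivial _ trivial hab (ih trivial)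

theorem conn_singleton (a : V) : Conn G {a} := by
  rintro P - u rfl v rfl h
  exact h

theorem Conn.exists_crossing {s : Set V} (hs : Conn G s) (P : V → Prop) {u v : V} (hu : u ∈ s)
    (hv : v ∈ s) (hPu : P u) (hPv : ¬ P v) : ∃ a ∈ s, ∃ b ∈ s, G.Adj a b ∧ P a ∧ ¬ P b := by
  by_contra h
  push Not at h
  exact hPv (hs P h u hu v hv hPu)

/-- A set is connected if every component of it meets a connected subset. -/
theorem conn_of_attached {s A : Set V} (hA : Conn G A) (hAs : A ⊆ s)
    (h : ∀ v ∈ s, ∀ P : V → Prop, (∀ a ∈ s, ∀ b ∈ s, G.Adj a b → P a → P b) → P v → ∃ a ∈ A, P a) :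
    Conn G s := by
  intro P hP u hu v hv hPu
  by_contra hPv
  obtain ⟨a, ha, hPa⟩ := h u hu P hP hPu
  obtain ⟨b, hb, hPb⟩ := h v hv (fun x => ¬ P x)
    (fun a ha b hb hab hPa hPb => hPa (hP b hb a ha hab.symm hPb)) hPv
  exact hPb (hA P (fun a ha b hb => hP a (hAs ha) b (hAs hb)) a ha b hb hPa)

theorem Conn.union {s t : Set V} (hs : Conn G s) (ht : Conn G t) {a b : V} (ha : a ∈ s)
    (hb : b ∈ t) (hab : G.Adj a b) : Conn G (s ∪ t) := by
  refine conn_of_attached hs Set.subset_union_left ?_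
  rintro v (hv | hv) P hP hPv
  · exact ⟨v, hv, hPv⟩
  · refine ⟨a, ha, hP b (.inr hb) a (.inl ha) hab.symm ?_⟩
    exact ht P (fun a ha b hb => hP a (.inr ha) b (.inr hb)) v hv b hb hPv

theorem Conn.insert {s : Set V} (hs : Conn G s) {a b : V} (ha : a ∈ s) (hab : G.Adj a b) :
    Conn G (insert b s) := by
  rw [Set.insert_eq]
  exact (conn_singleton b).union hs rfl ha hab.symm

theorem ball_subset_ball (G : SimpleGraph V) (R B : Set V) {m n : ℕ} (h : m ≤ n) :
    ball G R B m ⊆ ball G R B n :=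
  monotone_nat_of_le_succ (fun _ => Set.subset_union_left) h

theorem ball_subset (G : SimpleGraph V) (R B : Set V) (n : ℕ) : ball G R B n ⊆ B ∪ R := by
  induction n with
  | zero => exact Set.subset_union_left
  | succ n ih => exact Set.union_subset ih (Set.inter_subset_right.trans Set.subset_union_right)

theorem ball_induction {R B : Set V} {m : ℕ} {P : V → Prop} (hB : ∀ a ∈ B, P a)
    (hP : ∀ a ∈ ball G R B m, ∀ b ∈ ball G R B m, b ∈ R → G.Adj a b → P a → P b) :
    ∀ a ∈ ball G R B m, P a := by
  have key : ∀ n ≤ m, ∀ a ∈ ball G R B n, P a := by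
    intro n
    induction n with
    | zero => exact fun _ => hB
    | succ n ih =>
      rintro hn b (hb | ⟨⟨a, ha, hab⟩, hb⟩)
      · exact ih (by omega) b hb
      · exact hP a (ball_subset_ball G R B (by omega) ha) b
          (ball_subset_ball G R B hn (.inr ⟨⟨a, ha, hab⟩, hb⟩)) hb hab (ih (by omega) a ha)
  exact key m le_rfl

theorem conn_of_ball {S : Set V} {n : ℕ} (h : ∀ u ∈ S, ∀ v ∈ S, v ∈ ball G S {u} n) : Conn G S := by
  intro P hP u hu v hv hPu
  refine ball_induction (B := {u}) (by rintro _ rfl; exact hPu) ?_ v (h u hu v hv)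
  intro a ha b _ hb hab hPa
  refine hP a ?_ b hb hab hPa
  rcases ball_subset _ _ _ _ ha with rfl | ha
  exacts [hu, ha]

/-- `x 0, …, x (m - 1)` is an induced path. -/
def IsIndPath (G : SimpleGraph V) (m : ℕ) (x : ℕ → V) : Prop :=
  ∀ i j, i < j → j < m → x i ≠ x j ∧ (G.Adj (x i) (x j) ↔ j = i + 1)

/-- A shortest path from `B` to `v` within `R` is induced: its `i`-th vertex lies in the ball of
radius `i` and in no smaller one, so a repetition or a chord would bring some vertex too close to
`B`. -/
theorem exists_isIndPath_of_ball {R B : Set V} (hB : B ⊆ R) {d : ℕ} {v : V}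
    (hv : v ∈ ball G R B (d + 1)) (hv' : v ∉ ball G R B d) :
    ∃ x, IsIndPath G (d + 2) x ∧ ∀ i < d + 2, x i ∈ R := by
  have key : ∀ d v, v ∈ ball G R B d → (∀ j < d, v ∉ ball G R B j) → ∃ x : ℕ → V, x d = v ∧
      (∀ i ≤ d, x i ∈ ball G R B i ∧ ∀ j < i, x i ∉ ball G R B j) ∧
      ∀ i < d, G.Adj (x i) (x (i + 1)) := by
    intro d
    induction d with
    | zero =>
      intro v hv hv'
      refine ⟨fun _ => v, rfl, fun i hi => ?_, by simp⟩
      obtain rfl : i = 0 := by omega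
      exact ⟨hv, hv'⟩
    | succ d ih =>
      intro v hv hv'
      obtain hv | ⟨⟨a, ha, hav⟩, hvR⟩ := hv
      · exact absurd hv (hv' d (by omega))
      obtain ⟨x, rfl, hx, hadj⟩ := ih a ha fun j hj haj =>
        hv' (j + 1) (by omega) (.inr ⟨⟨a, haj, hav⟩, hvR⟩)
      refine ⟨fun i => if i ≤ d then x i else v, by simp, fun i hi => ?_, fun i hi => ?_⟩
      · rcases Nat.lt_or_eq_of_le hi with hi | rfl
        · simp only [if_pos (show i ≤ d by omega)]
          exact hx i (by omega)
        · simp only [if_neg (show ¬ d + 1 ≤ d by omega)]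
          exact ⟨.inr ⟨⟨_, ha, hav⟩, hvR⟩, hv'⟩
      · rcases Nat.lt_or_eq_of_le (Nat.le_of_lt_succ hi) with hi | rfl
        · simp only [if_pos (show i ≤ d by omega), if_pos (show i + 1 ≤ d by omega)]
          exact hadj i hi
        · simpa using hav
  obtain ⟨x, -, hx, hadj⟩ := key (d + 1) v hv fun j hj h =>
    hv' (ball_subset_ball G R B (by omega) h)
  have hR : ∀ i < d + 2, x i ∈ R := fun i hi =>
    (ball_subset G R B i (hx i (by omega)).1).elim (fun h => hB h) id
  refine ⟨x, fun i j hij hj => ⟨fun h => ?_, fun h => ?_, ?_⟩, hR⟩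
  · exact (hx j (by omega)).2 i hij (h ▸ (hx i (by omega)).1)
  · by_contra hne
    exact (hx j (by omega)).2 (i + 1) (by omega)
      (.inr ⟨⟨_, (hx i (by omega)).1, h⟩, hR j hj⟩)
  · rintro rfl
    exact hadj i (by omega)

theorem IsFree.false_of_isIndPath (hG : IsFree P1AddP5 G) {x : ℕ → V} (hx : IsIndPath G 5 x) {y : V}
    (hy : ∀ i < 5, x i ≠ y ∧ ¬ G.Adj y (x i)) : False := by
  refine hG ⟨⟨⟨Sum.elim (fun _ => y) (fun i => x i), ?_⟩, ?_⟩⟩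
  · rintro (i | i) (j | j) h
    · rw [Subsingleton.elim i j]
    · exact absurd h.symm (hy j j.2).1
    · exact absurd h (hy i i.2).1
    · rcases lt_trichotomy i j with hij | rfl | hij
      · exact absurd h (hx i j hij j.2).1
      · rfl
      · exact absurd h.symm (hx j i hij i.2).1
  · rintro (i | i) (j | j)
    · change G.Adj y y ↔ (SimpleGraph.pathGraph 1).Adj i j
      rw [Subsingleton.elim i j]
      simp
    · exact iff_of_false (hy j j.2).2 fun h => by simp at h
    · exact iff_of_false (fun h => (hy i i.2).2 h.symm) fun h => by simp at h
    · change G.Adj (x i) (x j) ↔ (SimpleGraph.pathGraph 5).Adj i j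
      rw [SimpleGraph.pathGraph_adj]
      rcases lt_trichotomy i j with hij | rfl | hij
      · rw [(hx i j hij j.2).2]
        have : (i : ℕ) < j := hij
        omega
      · simp
      · rw [G.adj_comm, (hx j i hij i.2).2]
        have : (j : ℕ) < i := hij
        omega

/-- In a `(P₁ + P₅)`-free graph, a shortest path within a set of vertices that misses the
neighbourhood of some further vertex has at most three edges. -/
theorem IsFree.ball_four_subset (hG : IsFree P1AddP5 G) {R B : Set V} (hB : B ⊆ R) {y : V}
    (hy : ∀ v ∈ R, v ≠ y ∧ ¬ G.Adj y v) : ball G R B 4 ⊆ ball G R B 3 := by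
  intro v hv
  by_contra hv'
  obtain ⟨x, hx, hR⟩ := exists_isIndPath_of_ball hB hv hv'
  exact hG.false_of_isIndPath hx fun i hi => hy _ (hR i hi)

/-- The first five vertices together with the seventh induce `P₁ + P₅`. -/
theorem IsFree.not_isIndPath_seven (hG : IsFree P1AddP5 G) {x : ℕ → V} (hx : IsIndPath G 7 x) :
    False := by
  refine hG.false_of_isIndPath (x := x) (y := x 6) (fun i j hij hj => hx i j hij (by omega))
    fun i hi => ⟨(hx i 6 (by omega) (by omega)).1, fun h => ?_⟩
  have := (hx i 6 (by omega) (by omega)).2.1 h.symm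
  omega

/-- In a `(P₁ + P₅)`-free graph, a shortest path within any set of vertices has at most five
edges. -/
theorem IsFree.ball_six_subset (hG : IsFree P1AddP5 G) {R B : Set V} (hB : B ⊆ R) :
    ball G R B 6 ⊆ ball G R B 5 := by
  intro v hv
  by_contra hv'
  obtain ⟨x, hx, -⟩ := exists_isIndPath_of_ball hB hv hv'
  exact hG.not_isIndPath_seven hx

/-- Balls of radius five are closed under the edges inside `R`, so they are unions of components of
`R`. This is what makes components definable. -/
theorem IsFree.mem_ball_of_adj (hG : IsFree P1AddP5 G) {R B : Set V} (hB : B ⊆ R) {a b : V}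
    (ha : a ∈ ball G R B 5) (hb : b ∈ R) (hab : G.Adj a b) : b ∈ ball G R B 5 :=
  hG.ball_six_subset hB (.inr ⟨⟨a, ha, hab⟩, hb⟩)

theorem IsFree.mem_ball_of_conn (hG : IsFree P1AddP5 G) {S : Set V} (hS : Conn G S) {u v : V}
    (hu : u ∈ S) (hv : v ∈ S) : v ∈ ball G S {u} 5 :=
  hS (fun v => v ∈ ball G S {u} 5)
    (fun _ _ _ hb hab ha => hG.mem_ball_of_adj (by simpa using hu) ha hb hab) u hu v hv
    (ball_subset_ball G S {u} (Nat.zero_le 5) rfl)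

/-- If the vertex `p` of the connected set `K` has no neighbour in `K` but `p'`, then all other
vertices of `K` have distance at most two from `p'`. -/
theorem IsFree.dist_le_two (hG : IsFree P1AddP5 G) {K : Set V} (hK : Conn G K) {y : V}
    (hy : ∀ v ∈ K, v ≠ y ∧ ¬ G.Adj y v) {p p' w : V} (hp : p ∈ K) (hw : w ∈ K)
    (hnbr : ∀ v ∈ K, G.Adj p v → v = p') :
    w = p ∨ w = p' ∨ G.Adj p' w ∨ ∃ m ∈ K, G.Adj p' m ∧ G.Adj m w := by
  -- As `K` avoids `y` and its neighbours, every vertex of `K` is within distance three of `p`; the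
  -- first step of a path from `p` leads to `p'`, which leaves two.
  have h3 : w ∈ ball G K {p} 3 := hK (fun v => v ∈ ball G K {p} 3)
    (fun a _ b hb hab ha => hG.ball_four_subset (by simpa using hp) hy (.inr ⟨⟨a, ha, hab⟩, hb⟩))
    p hp w hw (ball_subset_ball G K {p} (Nat.zero_le 3) rfl)
  have h1 : ∀ v ∈ ball G K {p} 1, v = p ∨ v = p' := by
    rintro v (rfl | ⟨⟨a, rfl, hav⟩, hv⟩)
    · exact .inl rfl
    · exact .inr (hnbr v hv hav)
  have h2 : ∀ v ∈ ball G K {p} 2, v ∈ K ∧ (v = p ∨ v = p' ∨ G.Adj p' v) := by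
    rintro v (hv | ⟨⟨a, ha, hav⟩, hv⟩)
    · refine ⟨(ball_subset G K {p} 1 hv).elim (fun h => by rw [h]; exact hp) id, ?_⟩
      exact (h1 v hv).imp id .inl
    · refine ⟨hv, ?_⟩
      rcases h1 a ha with rfl | rfl
      · exact .inr (.inl (hnbr v hv hav))
      · exact .inr (.inr hav)
  rcases h3 with hw | ⟨⟨a, ha, haw⟩, hw⟩
  · exact (h2 w hw).2.imp id fun h => h.imp id .inl
  · obtain ⟨haK, rfl | rfl | h⟩ := h2 a ha
    · exact .inr (.inl (hnbr w hw haw))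
    · exact .inr (.inr (.inl haw))
    · exact .inr (.inr (.inr ⟨a, haK, h, haw⟩))

end Connectivity

end LongestPathContractibility

/-! ### Connecting the neighbours of a connected set by two vertices. -/

namespace LongestPathContractibility

open Function

section Shrink

variable {V : Type*} {G : SimpleGraph V}

/-- The vertices of `Z` that can be reached from `c` within `Z`. -/
def reached (G : SimpleGraph V) (Z : Set V) (c : V) : Set V :=
  {z | z ∈ Z ∧ ∀ P : V → Prop, (∀ a ∈ Z, ∀ b ∈ Z, G.Adj a b → P a → P b) →
    (∀ a ∈ Z, a = c ∨ G.Adj c a → P a) → P z}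

theorem mem_reached_of_adj {Z : Set V} {c a b : V} (ha : a ∈ reached G Z c) (hb : b ∈ Z)
    (hab : G.Adj a b) : b ∈ reached G Z c :=
  ⟨hb, fun P hP hc => hP a ha.1 b hb hab (ha.2 P hP hc)⟩

theorem mem_reached {Z : Set V} {c a : V} (ha : a ∈ Z) (h : a = c ∨ G.Adj c a) :
    a ∈ reached G Z c :=
  ⟨ha, fun _ _ hc => hc a ha h⟩

theorem reached_subset_reached {Z : Set V} {c a : V}
    (h : ∀ z ∈ Z, z = c ∨ G.Adj c z → z ∈ reached G Z a) : reached G Z c ⊆ reached G Z a :=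
  fun _ hz => hz.2 (fun z => z ∈ reached G Z a) (fun _ _ _ hb hab ha => mem_reached_of_adj ha hb hab)
    h

theorem conn_insert_of_reached {Z : Set V} {c : V} (h : Z ⊆ reached G Z c) :
    Conn G (insert c Z) := by
  refine conn_of_attached (conn_singleton c) (by simp) ?_
  intro v hv P hP hPv
  refine ⟨c, rfl, ?_⟩
  by_contra hc
  rcases hv with rfl | hv
  · exact hc hPv
  · refine (h hv).2 (fun z => ¬ P z) (fun a ha b hb hab hPa hPb => hPa
      (hP b (.inr hb) a (.inr ha) hab.symm hPb)) ?_ hPv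
    rintro a ha (rfl | hca)
    · exact hc
    · exact fun hPa => hc (hP a (.inr ha) c (.inl rfl) hca.symm hPa)

/-- In a connected `(P₁ + P₅)`-free graph, let `X` and `W` be connected sets that miss
some vertex and its neighbourhood. Then the neighbours of `X` in `W` can be connected by at most two
vertices of `W`. -/
theorem IsFree.exists_conn_nbr [Finite V] (hG : IsFree P1AddP5 G) {X W : Set V} {y : V}
    (hX : Conn G X) (hW : Conn G W)
    (hyX : ∀ v ∈ X, v ≠ y ∧ ¬ G.Adj y v) (hyW : ∀ v ∈ W, v ≠ y ∧ ¬ G.Adj y v)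
    (hne : (nbr G X ∩ W).Nonempty) :
    ∃ s ∈ W, ∃ t ∈ W, Conn G (nbr G X ∩ W ∪ {s, t}) := by
  set Z := nbr G X ∩ W with hZ
  have hXc : ∀ c ∈ W, c ∉ Z → ∀ v ∈ X, ¬ G.Adj c v := fun c hc hcZ v hv h =>
    hcZ ⟨⟨v, hv, h.symm⟩, hc⟩
  -- If there is an induced path `z, c, c'` that leaves `Z` after its first vertex, then `c` and
  -- `c'` will do. Otherwise adjacent vertices of `W \ Z` have the same neighbours in `Z`, and a
  -- single vertex is enough.
  by_cases hcase : ∃ z ∈ Z, ∃ c ∈ W, ∃ c' ∈ W, c ∉ Z ∧ c' ∉ Z ∧ G.Adj z c ∧ G.Adj c c' ∧ ¬ G.Adj z c'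
  · obtain ⟨z, hz, c, hc, c', hc', hcZ, hcZ', hzc, hcc, hzc'⟩ := hcase
    refine ⟨c, hc, c', hc', ?_⟩
    have hA : Conn G {z, c, c'} := by
      have := ((conn_singleton z).insert rfl hzc).insert (.inl rfl) hcc
      convert this using 1
      ext v; simp; tauto
    refine conn_of_attached hA ?_ ?_
    · rintro v (rfl | rfl | rfl)
      · exact .inl hz
      · exact .inr (.inl rfl)
      · exact .inr (.inr rfl)
    rintro w (hw | hw) P hP hPw
    swap
    · exact ⟨w, .inr hw, hPw⟩
    obtain ⟨⟨x₁, hx₁, hxw⟩, hwW⟩ := hw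
    obtain ⟨⟨x₂, hx₂, hxz⟩, hzW⟩ := id hz
    have hK : Conn G (insert c' (insert c (insert z (insert w X)))) :=
      (((hX.insert hx₁ hxw).insert (.inr hx₂) hxz).insert (.inl rfl) hzc).insert (.inl rfl) hcc
    by_cases hwc' : G.Adj w c'
    · exact ⟨c', by simp, hP w (.inl ⟨⟨x₁, hx₁, hxw⟩, hwW⟩) c' (.inr (.inr rfl)) hwc' hPw⟩
    by_cases hwc : G.Adj w c
    · exact ⟨c, by simp, hP w (.inl ⟨⟨x₁, hx₁, hxw⟩, hwW⟩) c (.inr (.inl rfl)) hwc hPw⟩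
    -- In `X ∪ {w, z, c, c'}` the vertex `c'` has the only neighbour `c`, so `w` is within distance
    -- two of `c`. The only neighbours of `c` there are `z` and `c'`, whence `w` is adjacent to `z`.
    have hd := hG.dist_le_two hK (y := y) (p := c') (p' := c) (w := w) (by
      rintro v (rfl | rfl | rfl | rfl | hv)
      exacts [hyW _ hc', hyW _ hc, hyW _ hzW, hyW _ hwW, hyX _ hv]) (by simp) (by simp) (by
      rintro v (rfl | rfl | rfl | rfl | hv) h
      · exact absurd h (G.loopless.irrefl _)
      · rfl
      · exact absurd h.symm hzc'
      · exact absurd h.symm hwc'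
      · exact absurd h (hXc _ hc' hcZ' v hv))
    have hwZ : w ∈ Z := ⟨⟨x₁, hx₁, hxw⟩, hwW⟩
    rcases hd with rfl | rfl | h | ⟨m, hm, hcm, hmw⟩
    · exact absurd hwZ hcZ'
    · exact absurd hwZ hcZ
    · exact absurd h.symm hwc
    · rcases hm with rfl | rfl | rfl | rfl | hm
      · exact absurd hmw.symm hwc'
      · exact absurd hmw.symm hwc
      · exact ⟨m, by simp, hP w (.inl hwZ) m (.inl hz) hmw.symm hPw⟩
      · exact absurd hcm.symm hwc
      · exact absurd hcm (hXc _ hc hcZ m hm)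
  · push Not at hcase
    obtain ⟨z₀, hz₀⟩ := hne
    -- Choose `c` such that the components of `Z` which contain `c` or a neighbour of `c` have as
    -- many vertices as possible in total; the claim is that they cover `Z`.
    obtain ⟨c, hcW, hmax⟩ := Set.exists_max_image W (fun c => (reached G Z c).ncard)
      (Set.toFinite W) ⟨z₀, hz₀.2⟩
    refine ⟨c, hcW, c, hcW, ?_⟩
    have hgoal : Z ⊆ reached G Z c → Conn G (Z ∪ {c, c}) := fun h => by
      have := conn_insert_of_reached h
      convert this using 1
      ext v; simp
    refine hgoal fun z' hz' => ?_
    by_contra hz'c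
    have hcne : (reached G Z c).Nonempty := by
      rw [← Set.ncard_pos]
      refine lt_of_lt_of_le ?_ (hmax z₀ hz₀.2)
      rw [Set.ncard_pos]
      exact ⟨z₀, mem_reached hz₀ (.inl rfl)⟩
    obtain ⟨z₁, hz₁⟩ := hcne
    -- Since `W` is connected, an edge `ab` leaves the set consisting of the reached vertices and of
    -- their neighbours in `W \ Z`. The case assumption leaves one possibility only: `a` is outside
    -- `Z` and adjacent to a reached vertex, and `b` lies in `Z` but is not reached.
    obtain ⟨a, haW, b, hbW, hab, hPa, hPb⟩ := hW.exists_crossing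
      (fun w => ∃ z ∈ reached G Z c, z = w ∨ (w ∉ Z ∧ G.Adj w z)) hz₁.1.2 hz'.2
      ⟨z₁, hz₁, .inl rfl⟩ (by
        rintro ⟨z, hz, rfl | ⟨h, -⟩⟩
        · exact hz'c hz
        · exact h hz')
    obtain ⟨z, hz, hza⟩ := hPa
    have hbne : b ∉ reached G Z c := fun h => hPb ⟨b, h, .inl rfl⟩
    have hbz : ∀ z ∈ reached G Z c, b ∉ Z → ¬ G.Adj b z := fun z hz hbZ h =>
      hPb ⟨z, hz, .inr ⟨hbZ, h⟩⟩
    rcases hza with rfl | ⟨haZ, haz⟩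
    · by_cases hbZ : b ∈ Z
      · exact hbne (mem_reached_of_adj hz hbZ hab)
      · exact hbz _ hz hbZ hab.symm
    by_cases hbZ : b ∈ Z
    swap
    · exact hbz z hz hbZ (hcase z hz.1 a haW b hbW haZ hbZ haz.symm hab).symm
    have hba : b ∈ reached G Z a := mem_reached hbZ (.inr hab)
    have hza : z ∈ reached G Z a := mem_reached hz.1 (.inr haz)
    have hnot : ¬ reached G Z c ⊆ reached G Z a := fun h =>
      absurd (hmax a haW) (not_le.2 (Set.ncard_lt_ncard ⟨h, fun h' => hbne (h' hba)⟩))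
    -- Since `a` reaches `b` and `c` does not, maximality of `c` yields a vertex that `c` reaches
    -- directly and `a` does not reach.
    obtain ⟨z₂, hz₂, hcz, hz₂a⟩ : ∃ z₂ ∈ Z, (z₂ = c ∨ G.Adj c z₂) ∧ z₂ ∉ reached G Z a := by
      by_contra h
      push Not at h
      exact hnot (reached_subset_reached h)
    have hz₂c : z₂ ∈ reached G Z c := mem_reached hz₂ hcz
    rcases hcz with rfl | hcz
    · refine hz.2 (fun x => x ∉ reached G Z a) (fun u hu v hv huv h h' => h
        (mem_reached_of_adj h' hu huv.symm)) ?_ hza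
      rintro u hu (rfl | h)
      · exact hz₂a
      · exact fun h' => hz₂a (mem_reached_of_adj h' hz₂ h.symm)
    have haz₂ : ¬ G.Adj a z₂ := fun h => hz₂a (mem_reached hz₂ (.inr h))
    have hbz₂ : ¬ G.Adj z₂ b := fun h => hbne (mem_reached_of_adj hz₂c hbZ h)
    have hcb : ¬ G.Adj c b := fun h => hbne (mem_reached hbZ (.inr h))
    have hcZ : c ∉ Z := fun hcZ => by
      have hca : c ∉ reached G Z a := fun h => hz₂a (mem_reached_of_adj h hz₂ hcz)
      refine hz.2 (fun x => x ∉ reached G Z a) (fun u hu v hv huv h h' => h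
        (mem_reached_of_adj h' hu huv.symm)) ?_ hza
      rintro u hu (rfl | h)
      · exact hca
      · exact fun h' => hca (mem_reached_of_adj h' hcZ h.symm)
    have hac : ¬ G.Adj c a := fun h =>
      haz₂ (hcase z₂ hz₂ c hcW a haW hcZ haZ hcz.symm h).symm
    obtain ⟨⟨x₁, hx₁, hxz⟩, hz₂W⟩ := id hz₂
    obtain ⟨⟨x₂, hx₂, hxb⟩, -⟩ := id hbZ
    have hK : Conn G (insert c (insert a (insert z₂ (insert b X)))) :=
      (((hX.insert hx₂ hxb).insert (.inr hx₁) hxz).insert (.inr (.inl rfl)) hab.symm).insert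
        (.inr (.inl rfl)) hcz.symm
    -- In `X ∪ {b, z₂, a, c}` the vertex `c` has the only neighbour `z₂`, so `a` would be within
    -- distance two of `z₂`; but they are not adjacent and have no common neighbour in this set.
    have hd := hG.dist_le_two hK (y := y) (p := c) (p' := z₂) (w := a) (by
      rintro v (rfl | rfl | rfl | rfl | hv)
      exacts [hyW _ hcW, hyW _ haW, hyW _ hz₂W, hyW _ hbW, hyX _ hv]) (by simp) (by simp) (by
      rintro v (rfl | rfl | rfl | rfl | hv) h
      · exact absurd h (G.loopless.irrefl _)
      · exact absurd h hac
      · rfl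
      · exact absurd h hcb
      · exact absurd h (hXc _ hcW hcZ v hv))
    rcases hd with rfl | rfl | h | ⟨m, hm, hzm, hma⟩
    · exact hcb hab
    · exact haZ hz₂
    · exact haz₂ h.symm
    · rcases hm with rfl | rfl | rfl | rfl | hm
      · exact hac hma
      · exact haz₂ hzm.symm
      · exact haz₂ hma.symm
      · exact hbz₂ hzm
      · exact hXc _ haW haZ m hm hma.symm

end Shrink

end LongestPathContractibility

/-! ### Contractions as maps with connected fibres; path contractions with singleton end bags. -/

namespace LongestPathContractibility

open Function

universe u v

section Contraction

variable {V : Type u} {W : Type v} {G : SimpleGraph V} {H : SimpleGraph W}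

/-- `f` exhibits `H` as a contraction of `G`: the preimages of the vertices of `H` are connected and
nonempty, and two of them are adjacent exactly if the vertices of `H` are. -/
structure IsContractionMap (H : SimpleGraph W) (G : SimpleGraph V) (f : V → W) : Prop where
  surjective : Surjective f
  conn : ∀ a, Conn G {v | f v = a}
  adj : ∀ a b, a ≠ b → (H.Adj a b ↔ ∃ u v, f u = a ∧ f v = b ∧ G.Adj u v)

open Classical in
/-- The quotient map of an edge contraction. -/
noncomputable def contractMap {u v : V} (h : u ≠ v) (x : V) : {x : V // x ≠ v} :=
  if hx : x = v then ⟨u, h⟩ else ⟨x, hx⟩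

theorem contractMap_self {u v : V} (h : u ≠ v) : contractMap h v = ⟨u, h⟩ := by simp [contractMap]

theorem contractMap_coe {u v : V} (h : u ≠ v) (x : {x : V // x ≠ v}) : contractMap h x = x := by
  simp [contractMap, x.2]

theorem contractMap_adj {u v : V} (h : u ≠ v) {a b : V} (hab : G.Adj a b) :
    contractMap h a = contractMap h b ∨
      (contractEdge G u v).Adj (contractMap h a) (contractMap h b) := by
  refine or_iff_not_imp_left.2 fun hne => ⟨hne, ?_⟩
  by_cases ha : a = v <;> by_cases hb : b = v
  · exact absurd (by rw [ha, hb]) hne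
  · subst ha
    simp only [contractMap, dif_neg hb]
    exact .inr (.inl ⟨rfl, hab⟩)
  · subst hb
    simp only [contractMap, dif_neg ha]
    exact .inr (.inr ⟨rfl, hab.symm⟩)
  · simp only [contractMap, dif_neg ha, dif_neg hb]
    exact .inl hab

theorem exists_adj_of_contractEdge_adj {u v : V} (h : u ≠ v) {x y : {x : V // x ≠ v}}
    (hxy : (contractEdge G u v).Adj x y) :
    ∃ a b, contractMap h a = x ∧ contractMap h b = y ∧ G.Adj a b := by
  obtain ⟨-, hxy | ⟨hx, hvy⟩ | ⟨hy, hvx⟩⟩ := hxy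
  · exact ⟨x, y, contractMap_coe h x, contractMap_coe h y, hxy⟩
  · exact ⟨v, y, by rw [contractMap_self]; exact Subtype.ext hx.symm, contractMap_coe h y, hvy⟩
  · exact ⟨x, v, contractMap_coe h x, by rw [contractMap_self]; exact Subtype.ext hy.symm, hvx.symm⟩

theorem IsContractionMap.of_contractEdge {u v : V} (huv : G.Adj u v) {f : {x : V // x ≠ v} → W}
    (hf : IsContractionMap H (contractEdge G u v) f) :
    IsContractionMap H G fun x => f (contractMap huv.ne x) := by
  have hne := huv.ne
  refine ⟨fun a => ?_, fun a P hP p hp q hq hPp => ?_, fun a b hab => ?_⟩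
  · obtain ⟨x, rfl⟩ := hf.surjective a
    exact ⟨x, congrArg f (contractMap_coe hne x)⟩
  · have hc : ∀ x, f (contractMap hne x) = a → (P x ↔ P (contractMap hne x)) := by
      intro x hx
      by_cases hxv : x = v
      · subst hxv
        have hu : f (contractMap hne u) = a := by
          rw [← hx, contractMap_self]; exact congrArg f (contractMap_coe hne ⟨u, hne⟩)
        rw [contractMap_self]
        exact ⟨hP x hx u hu huv.symm, hP u hu x hx huv⟩
      · simp [contractMap, hxv]
    rw [hc q hq]
    refine hf.conn a (fun x => P x) ?_ (contractMap hne p) hp (contractMap hne q) hq ((hc p hp).1 hPp)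
    intro x hx y hy hxy hPx
    obtain ⟨c, d, rfl, rfl, hcd⟩ := exists_adj_of_contractEdge_adj hne hxy
    exact (hc d hy).1 (hP c hx d hy hcd ((hc c hx).2 hPx))
  · rw [hf.adj a b hab]
    constructor
    · rintro ⟨x, y, rfl, rfl, hxy⟩
      obtain ⟨c, d, rfl, rfl, hcd⟩ := exists_adj_of_contractEdge_adj hne hxy
      exact ⟨c, d, rfl, rfl, hcd⟩
    · rintro ⟨c, d, rfl, rfl, hcd⟩
      refine ⟨_, _, rfl, rfl, (contractMap_adj hne hcd).resolve_left fun h => hab ?_⟩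
      rw [h]

theorem HasContraction.exists_map (h : HasContraction H G) : ∃ f, IsContractionMap H G f := by
  induction h with
  | of_iso e =>
    obtain ⟨e⟩ := e
    refine ⟨e, e.surjective, ?_, fun a b _ => ⟨fun h => ⟨e.symm a, e.symm b, by simp, by simp, ?_⟩, ?_⟩⟩
    · rintro a P - p rfl q hq hp
      rwa [e.injective hq]
    · rwa [e.symm.map_rel_iff]
    · rintro ⟨p, q, rfl, rfl, h⟩
      rwa [e.map_rel_iff]
  | contract u v huv _ ih =>
    obtain ⟨f, hf⟩ := ih
    exact ⟨_, hf.of_contractEdge huv⟩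

theorem IsContractionMap.contractEdge {f : V → W} (hf : IsContractionMap H G f) {u v : V}
    (huv : G.Adj u v) (huvf : f u = f v) :
    IsContractionMap H (contractEdge G u v) fun x => f x := by
  have hne := huv.ne
  have hc : ∀ x, f (contractMap hne x) = f x := by
    intro x
    by_cases hx : x = v
    · subst hx; rw [contractMap_self]; exact huvf
    · simp [contractMap, hx]
  refine ⟨fun a => ?_, fun a P hP p hp q hq hPp => ?_, fun a b hab => ?_⟩
  · obtain ⟨x, rfl⟩ := hf.surjective a
    exact ⟨_, hc x⟩
  · have := hf.conn a (fun x => P (contractMap hne x)) ?_ p hp q hq (by rwa [contractMap_coe])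
    · rwa [contractMap_coe] at this
    intro c hca d hda hcd hPc
    rcases contractMap_adj hne hcd with h | h
    · rwa [← h]
    · exact hP _ ((hc c).trans hca) _ ((hc d).trans hda) h hPc
  · rw [hf.adj a b hab]
    constructor
    · rintro ⟨c, d, rfl, rfl, hcd⟩
      refine ⟨_, _, hc c, hc d, (contractMap_adj hne hcd).resolve_left fun h => hab ?_⟩
      rw [← hc c, h, hc]
    · rintro ⟨x, y, rfl, rfl, hxy⟩
      obtain ⟨c, d, rfl, rfl, hcd⟩ := exists_adj_of_contractEdge_adj hne hxy
      exact ⟨c, d, (hc c).symm, (hc d).symm, hcd⟩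

/-- Induction on the number of vertices: a fibre with two vertices is connected, so it contains an
edge, and contracting this edge leaves a contraction map. -/
theorem IsContractionMap.hasContraction [Finite V] {f : V → W} (hf : IsContractionMap H G f) :
    HasContraction H G := by
  obtain ⟨n, hn⟩ : ∃ n, Nat.card V = n := ⟨_, rfl⟩
  induction n using Nat.strong_induction_on generalizing V with
  | _ n ih =>
    by_cases hinj : Injective f
    · refine .of_iso ⟨⟨Equiv.ofBijective f ⟨hinj, hf.surjective⟩, ?_⟩⟩
      intro a b
      change H.Adj (f a) (f b) ↔ G.Adj a b
      by_cases hab : a = b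
      · subst hab; simp
      rw [hf.adj _ _ (hinj.ne hab)]
      constructor
      · rintro ⟨u, v, hu, hv, huv⟩
        rwa [← hinj hu, ← hinj hv]
      · exact fun h => ⟨a, b, rfl, rfl, h⟩
    · simp only [Injective, not_forall] at hinj
      obtain ⟨p, q, hpq, hne⟩ := hinj
      obtain ⟨u, hu, v, hv, huv, -, -⟩ := (hf.conn (f p)).exists_crossing (fun x => x = p)
        (u := p) (v := q) rfl hpq.symm rfl (fun h => hne h.symm)
      have h1 := hf.contractEdge huv (hu.trans hv.symm)
      refine .contract u v huv (ih (Nat.card {x : V // x ≠ v}) ?_ h1 rfl)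
      rw [← hn]
      exact Finite.card_subtype_lt (x := v) (by simp)

end Contraction

section Path

variable {V : Type u} {G : SimpleGraph V}

/-- `f` exhibits the path on `{0, …, k - 1}` as a contraction of the connected graph `G`. -/
structure IsPathMap (G : SimpleGraph V) (k : ℕ) (f : V → ℕ) : Prop where
  lt : ∀ v, f v < k
  surj : ∀ i < k, ∃ v, f v = i
  conn : ∀ i, Conn G {v | f v = i}
  adj : ∀ u v, G.Adj u v → f v ≤ f u + 1

/-- An edge leaving the union of the bags up to `i` exists by connectedness and can only lead from
bag `i` to bag `i + 1`. Thus `IsPathMap` need not demand that consecutive bags are adjacent. -/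
theorem IsPathMap.exists_adj (hG : Conn G Set.univ) {k : ℕ} {f : V → ℕ} (hf : IsPathMap G k f)
    {i : ℕ} (hi : i + 1 < k) : ∃ u v, f u = i ∧ f v = i + 1 ∧ G.Adj u v := by
  obtain ⟨u₀, hu₀⟩ := hf.surj i (by omega)
  obtain ⟨v₀, hv₀⟩ := hf.surj (i + 1) hi
  obtain ⟨u, -, v, -, huv, hu, hv⟩ := hG.exists_crossing (fun x => f x ≤ i) (u := u₀) (v := v₀)
    trivial trivial hu₀.le (by omega)
  have := hf.adj u v huv
  exact ⟨u, v, by omega, by omega, huv⟩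

theorem hasContraction_pathGraph_iff [Finite V] (hG : Conn G Set.univ) {k : ℕ} :
    HasContraction (SimpleGraph.pathGraph k) G ↔ ∃ f, IsPathMap G k f := by
  constructor
  · intro h
    obtain ⟨f, hf⟩ := h.exists_map
    refine ⟨fun v => f v, fun v => (f v).2, fun i hi => ?_, fun i => ?_, fun u v huv => ?_⟩
    · obtain ⟨v, hv⟩ := hf.surjective ⟨i, hi⟩
      exact ⟨v, by rw [hv]⟩
    · by_cases hi : i < k
      · convert hf.conn ⟨i, hi⟩ using 3 with v
        simp [Fin.ext_iff]
      · rintro P - u hu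
        exact absurd (hu ▸ (f u).2) hi
    · by_cases h : f u = f v
      · rw [h]; omega
      · have := (hf.adj _ _ h).2 ⟨u, v, rfl, rfl, huv⟩
        rw [SimpleGraph.pathGraph_adj] at this
        change (f v : ℕ) ≤ f u + 1
        omega
  · rintro ⟨f, hf⟩
    refine IsContractionMap.hasContraction (f := fun v => ⟨f v, hf.lt v⟩)
      ⟨fun i => ?_, fun i => ?_, fun i j hij => ?_⟩
    · obtain ⟨v, hv⟩ := hf.surj i i.2
      exact ⟨v, Fin.ext hv⟩
    · convert hf.conn i using 3 with v
      simp [Fin.ext_iff]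
    · rw [SimpleGraph.pathGraph_adj]
      have hij' : (i : ℕ) ≠ j := fun h => hij (Fin.ext h)
      constructor
      · rintro (h | h)
        · obtain ⟨u, v, hu, hv, huv⟩ := hf.exists_adj hG (i := i) (by omega)
          exact ⟨u, v, Fin.ext hu, Fin.ext (by simp [hv, h]), huv⟩
        · obtain ⟨u, v, hu, hv, huv⟩ := hf.exists_adj hG (i := j) (by omega)
          exact ⟨v, u, Fin.ext (by simp [hv, h]), Fin.ext hu, huv.symm⟩
      · rintro ⟨u, v, rfl, rfl, huv⟩
        have h1 := hf.adj u v huv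
        have h2 := hf.adj v u huv.symm
        simp only at hij' ⊢
        omega

theorem IsPathMap.reverse {k : ℕ} {f : V → ℕ} (hf : IsPathMap G k f) :
    IsPathMap G k fun v => k - 1 - f v := by
  refine ⟨fun v => ?_, fun i hi => ?_, fun i => ?_, fun u v huv => ?_⟩
  · have := hf.lt v; omega
  · obtain ⟨v, hv⟩ := hf.surj (k - 1 - i) (by omega)
    exact ⟨v, by simp only [hv]; omega⟩
  · by_cases hi : i < k
    · convert hf.conn (k - 1 - i) using 3 with v
      have := hf.lt v
      omega
    · rintro P - u hu
      have := hf.lt u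
      have : k - 1 - f u = i := hu
      omega
  · have h1 := hf.adj v u huv.symm
    have h2 := hf.lt u
    have h3 := hf.lt v
    change k - 1 - f v ≤ k - 1 - f u + 1
    omega

/-- A maximal connected proper subset of `S` that contains `B` misses just one vertex, since it
could be extended along an edge leaving it. -/
theorem exists_conn_diff_singleton [Finite V] {S B : Set V} (hS : Conn G S) (hB : Conn G B)
    (hBS : B ⊆ S) (hne : B.Nonempty) (hne' : (S \ B).Nonempty) :
    ∃ x ∈ S \ B, Conn G (S \ {x}) := by
  obtain ⟨Y, ⟨hBY, hYS, hY⟩, hmax⟩ := Set.exists_max_image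
    {Y : Set V | B ⊆ Y ∧ Y ⊂ S ∧ Conn G Y} Set.ncard (Set.toFinite _)
    ⟨B, subset_rfl, ⟨hBS, fun h => hne'.elim fun x hx => hx.2 (h hx.1)⟩, hB⟩
  obtain ⟨b, hb⟩ := hne
  obtain ⟨c, hcS, hcY⟩ := Set.exists_of_ssubset hYS
  obtain ⟨p, hp, x, hx, hpx, hpY, hxY⟩ := hS.exists_crossing (· ∈ Y) (hBS hb) hcS (hBY hb) hcY
  have hins : insert x Y = S := by
    by_contra h
    have h1 := hmax (insert x Y) ⟨hBY.trans (Set.subset_insert _ _),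
      (Set.insert_subset hx hYS.1).ssubset_of_ne h, hY.insert hpY hpx⟩
    rw [Set.ncard_insert_of_notMem hxY] at h1
    omega
  refine ⟨x, ⟨hx, fun h => hxY (hBY h)⟩, ?_⟩
  rwa [← hins, Set.insert_sdiff_of_mem _ (Set.mem_singleton x), Set.sdiff_singleton_eq_self hxY]

/-- In a contraction to a path the first bag may be assumed to be a singleton. -/
theorem IsPathMap.exists_singleton [Finite V] (hG : Conn G Set.univ) {k : ℕ} {f : V → ℕ}
    (hf : IsPathMap G k f) (hk : 2 ≤ k) :
    ∃ f', IsPathMap G k f' ∧ (∀ v, f v ≠ 0 → f' v = f v) ∧ (∀ v, f v = 0 → f' v ≤ 1) ∧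
      ∃ x, ∀ v, f' v = 0 ↔ v = x := by
  obtain ⟨a, b, ha, hb, hab⟩ := hf.exists_adj hG (i := 0) (by omega)
  have hS := (hf.conn 0).union (hf.conn (0 + 1)) ha hb hab
  -- All vertices of bag `0` except `x` will be moved to bag `1`, which thereby stays connected.
  obtain ⟨x, hx, hxc⟩ := exists_conn_diff_singleton hS (hf.conn (0 + 1)) Set.subset_union_right
    ⟨b, hb⟩ ⟨a, .inl ha, by simp [ha]⟩
  have hx0 : f x = 0 := hx.1.resolve_right hx.2
  classical
  refine ⟨fun v => if f v = 0 ∧ v ≠ x then 1 else f v, ⟨fun v => ?_, fun i hi => ?_, fun i => ?_,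
    fun u v huv => ?_⟩, fun v hv => by simp [hv], fun v hv => ?_, x, fun v => ?_⟩
  · have := hf.lt v
    split_ifs <;> omega
  · rcases Nat.eq_zero_or_pos i with rfl | hi'
    · exact ⟨x, by simp [hx0]⟩
    · obtain ⟨v, rfl⟩ := hf.surj i hi
      exact ⟨v, by simp [hi'.ne']⟩
  · rcases Nat.lt_trichotomy i 1 with hi | rfl | hi
    · obtain rfl : i = 0 := by omega
      convert conn_singleton (G := G) x
      ext v
      by_cases hv : v = x
      · simp [hv, hx0]
      · by_cases hv0 : f v = 0 <;> simp [hv, hv0]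
    · convert hxc using 1
      ext v
      by_cases hv : v = x
      · simp [hv, hx0]
      · by_cases hv0 : f v = 0 <;> simp [hv, hv0]
    · convert hf.conn i using 3 with v
      split_ifs with h
      · omega
      · rfl
  · have := hf.adj u v huv
    split_ifs <;> omega
  · dsimp only
    split_ifs <;> omega
  · by_cases hv : v = x
    · simp [hv, hx0]
    · by_cases hv0 : f v = 0 <;> simp [hv, hv0]

/-- In a contraction to a path the first and the last bag may be assumed to be singletons. -/
theorem IsPathMap.exists_singletons [Finite V] (hG : Conn G Set.univ) {k : ℕ} {f : V → ℕ}
    (hf : IsPathMap G k f) (hk : 3 ≤ k) :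
    ∃ f', IsPathMap G k f' ∧ ∃ x y, ∀ v, (f' v = 0 ↔ v = x) ∧ (f' v = k - 1 ↔ v = y) := by
  obtain ⟨f₁, hf₁, -, -, y, hy⟩ := hf.exists_singleton hG (by omega)
  -- The second application alters bag `0` only and moves its vertices no further than to bag `1 < k
  -- - 1`, so the other end bag remains `{y}`.
  obtain ⟨f₂, hf₂, h1, h2, x, hx⟩ := hf₁.reverse.exists_singleton hG (by omega)
  refine ⟨f₂, hf₂, x, y, fun v => ⟨hx v, ?_⟩⟩
  rw [← hy]
  have h3 := h1 v
  have h4 := h2 v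
  have h5 := hf₁.lt v
  omega

end Path

end LongestPathContractibility

/-! ### Definable bags, the bound `k ≤ 6`, and cutting a connected set in two. -/

namespace LongestPathContractibility

open Function

section Bags

variable {V : Type*} {G : SimpleGraph V}

/-- The radius `5` in `IsBags` loses nothing, because a connected set has diameter at most five
inside itself. -/
theorem IsFree.isBags_iff (hG : IsFree P1AddP5 G) {k : ℕ} {f : V → ℕ} :
    IsBags G (fun i : Fin k => {v | f v = i}) ↔ IsPathMap G k f := by
  constructor
  · intro h
    have hlt : ∀ v, f v < k := fun v => by
      obtain ⟨i, hi⟩ := h.cover v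
      have hi : f v = i := hi
      rw [hi]; exact i.2
    refine ⟨hlt, fun i hi => h.nonempty ⟨i, hi⟩, fun i => ?_, fun u v huv => ?_⟩
    · by_cases hi : i < k
      · exact conn_of_ball (h.conn ⟨i, hi⟩)
      · rintro P - u hu
        have hu : f u = i := hu
        exact absurd (hu ▸ hlt u) hi
    · by_contra hlt'
      exact h.far ⟨f u, hlt u⟩ ⟨f v, hlt v⟩ (by simp only; omega) v ⟨u, rfl, huv⟩ rfl
  · intro h
    refine ⟨fun v => ⟨⟨f v, h.lt v⟩, rfl⟩, fun i => h.surj i i.2, fun i j hij v hv hv' => ?_,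
      fun i j hij v hv hv' => ?_, fun i u hu v hv => hG.mem_ball_of_conn (h.conn i) hu hv⟩
    · have hv : f v = i := hv
      have hv' : f v = j := hv'
      have : (i : ℕ) < j := hij
      omega
    · obtain ⟨u, hu, huv⟩ := hv
      have hu : f u = i := hu
      have hv' : f v = j := hv'
      have := h.adj u v huv
      omega

/-- A `(P₁ + P₅)`-free graph cannot be contracted to a path on more than six vertices. -/
theorem IsFree.le_six (hG : IsFree P1AddP5 G) (hc : Conn G Set.univ) {k : ℕ} {f : V → ℕ}
    (hf : IsPathMap G k f) : k ≤ 6 := by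
  by_contra hk
  obtain ⟨u, hu⟩ := hf.surj 0 (by omega)
  obtain ⟨v, hv⟩ := hf.surj 6 (by omega)
  have key : ∀ n, ∀ w ∈ ball G Set.univ {u} n, f w ≤ n := by
    intro n
    induction n with
    | zero => rintro _ rfl; exact hu.le
    | succ n ih =>
      rintro b (hb | ⟨⟨a, ha, hab⟩, -⟩)
      · exact (ih b hb).trans (Nat.le_succ n)
      · exact (hf.adj a b hab).trans (Nat.succ_le_succ (ih a ha))
  have := key 5 v (hG.mem_ball_of_conn hc trivial trivial)
  omega

open Classical in
/-- The position of the first set in the list that contains `v`. -/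
noncomputable def rank : List (Set V) → V → ℕ
  | [], _ => 0
  | s :: l, v => if v ∈ s then 0 else rank l v + 1

/-- The part of `U` that is closer connected to `C` than to `D`: the set `C` together with all
components of `U \ (C ∪ D)` that are adjacent to `C`. -/
def split (G : SimpleGraph V) (U C D : Set V) : Set V :=
  C ∪ ball G (U \ (C ∪ D)) (nbr G C ∩ (U \ (C ∪ D))) 5

theorem split_subset {U C D : Set V} (hC : C ⊆ U) : split G U C D ⊆ U :=
  Set.union_subset hC fun _ hv => (ball_subset _ _ _ _ hv).elim (fun h => h.2.1) (fun h => h.1)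

theorem disjoint_split {U C D : Set V} (hCD : Disjoint C D) : Disjoint (split G U C D) D := by
  rw [Set.disjoint_left] at *
  rintro v (hv | hv) hD
  · exact hCD hv hD
  · rcases ball_subset _ _ _ _ hv with h | h
    · exact h.2.2 (.inr hD)
    · exact h.2 (.inr hD)

theorem conn_split {U C D : Set V} (hC : Conn G C) : Conn G (split G U C D) := by
  refine conn_of_attached hC Set.subset_union_left fun v hv P hP hPv => ?_
  by_contra! h
  rcases hv with hv | hv
  · exact h v hv hPv
  refine ball_induction (P := fun v => ¬ P v) ?_ ?_ v hv hPv
  · rintro b ⟨⟨a, ha, hab⟩, hb⟩ hPb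
    exact h a ha (hP b (.inr (ball_subset_ball _ _ _ (Nat.zero_le 5) ⟨⟨a, ha, hab⟩, hb⟩)) a (.inl ha)
      hab.symm hPb)
  · exact fun a ha b hb _ hab hPa hPb => hPa (hP b (.inr hb) a (.inr ha) hab.symm hPb)

/-- A component of `U \ (C ∪ D)` that is left over has no neighbour in `C`; as `U` is connected and
`C` is not empty, it must be attached to `D`. -/
theorem IsFree.conn_diff_split (hG : IsFree P1AddP5 G) {U C D : Set V} (hU : Conn G U)
    (hD : Conn G D) (hCU : C ⊆ U) (hDU : D ⊆ U) (hCD : Disjoint C D) (hne : C.Nonempty) :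
    Conn G (U \ split G U C D) := by
  have hdis := Set.disjoint_left.1 (disjoint_split (G := G) (U := U) hCD)
  refine conn_of_attached hD (fun v hv => ⟨hDU hv, fun h => hdis h hv⟩) fun v hv P hP hPv => ?_
  by_contra! h
  obtain ⟨c, hc⟩ := hne
  obtain ⟨a, -, b, hbU, hab, ⟨ha, hPa⟩, hb⟩ := hU.exists_crossing
    (fun x => x ∈ U \ split G U C D ∧ P x) hv.1 (hCU hc) ⟨hv, hPv⟩ fun h => h.1.2 (.inl hc)
  have haR : a ∈ U \ (C ∪ D) :=
    ⟨ha.1, fun h' => h'.elim (fun h' => ha.2 (.inl h')) fun h' => h a h' hPa⟩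
  by_cases hbs : b ∈ split G U C D
  · rcases hbs with hbC | hbs
    · exact ha.2 (.inr (ball_subset_ball _ _ _ (Nat.zero_le 5) ⟨⟨b, hbC, hab.symm⟩, haR⟩))
    · exact ha.2 (.inr (hG.mem_ball_of_adj Set.inter_subset_right hbs haR hab.symm))
  · exact hb ⟨⟨hbU, hbs⟩, hP a ha b ⟨hbU, hbs⟩ hab hPa⟩

end Bags

/-! ### Sorting the components outside the ends by their attachment to the two sides. -/

section Middle

variable {V : Type*} {G : SimpleGraph V}

/-- The vertices outside of `x`, `y`, `A` and `B`. -/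
def rest (x y : V) (A B : Set V) : Set V := ({x} ∪ {y} ∪ (A ∪ B))ᶜ

/-- The components of the rest that are adjacent to `A`. -/
def touched (G : SimpleGraph V) (x y : V) (A B : Set V) : Set V :=
  ball G (rest x y A B) (nbr G A ∩ rest x y A B) 5

/-- The components of the rest that are adjacent to `A` and to `B`. -/
def middle (G : SimpleGraph V) (x y : V) (A B : Set V) : Set V :=
  touched G x y A B ∩ touched G y x B A

/-- The set `A` and the components of the rest that are adjacent to `A` only. -/
def side (G : SimpleGraph V) (x y : V) (A B : Set V) : Set V :=
  A ∪ touched G x y A B \ touched G y x B A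

theorem rest_comm (x y : V) (A B : Set V) : rest y x B A = rest x y A B := by
  rw [rest, rest, Set.union_comm {y}, Set.union_comm B]

theorem middle_comm (x y : V) (A B : Set V) : middle G y x B A = middle G x y A B :=
  Set.inter_comm _ _

/-- A contraction to a path whose end bags are `{x}` and `{y}`, with connected sets `A` and `B` in
the bags next to them that contain all neighbours of `x` and of `y`. -/
structure Ends (G : SimpleGraph V) (k : ℕ) (f : V → ℕ) (x y : V) (A B : Set V) : Prop where
  map : IsPathMap G k f
  eq_left : ∀ v, f v = 0 ↔ v = x
  eq_right : ∀ v, f v = k - 1 ↔ v = y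
  conn_left : Conn G A
  conn_right : Conn G B
  left : ∀ v ∈ A, f v = 1
  right : ∀ v ∈ B, f v = k - 2
  nbr_left : ∀ v, G.Adj x v → v ∈ A
  nbr_right : ∀ v, G.Adj y v → v ∈ B

variable {k : ℕ} {f : V → ℕ} {x y : V} {A B : Set V}

theorem Ends.reverse (h : Ends G k f x y A B) (hk : 5 ≤ k) :
    Ends G k (fun v => k - 1 - f v) y x B A := by
  have hlt := h.map.lt
  refine ⟨h.map.reverse, fun v => ?_, fun v => ?_, h.conn_right, h.conn_left, fun v hv => ?_,
    fun v hv => ?_, h.nbr_right, h.nbr_left⟩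
  · rw [← h.eq_right]; have := hlt v; omega
  · rw [← h.eq_left]; have := hlt v; omega
  · have := h.right v hv; omega
  · have := h.left v hv; omega

theorem mem_rest_iff {v : V} : v ∈ rest x y A B ↔ v ≠ x ∧ v ≠ y ∧ v ∉ A ∧ v ∉ B := by
  simp only [rest, Set.mem_compl_iff, Set.mem_union, Set.mem_singleton_iff]
  tauto

theorem touched_subset : touched G x y A B ⊆ rest x y A B := fun _ hv =>
  (ball_subset _ _ _ _ hv).elim (fun h => h.2) id

theorem mem_touched_of_mem {a b : V} (ha : a ∈ A) (hb : b ∈ rest x y A B) (hab : G.Adj a b) :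
    b ∈ touched G x y A B :=
  ball_subset_ball _ _ _ (Nat.zero_le 5) ⟨⟨a, ha, hab⟩, hb⟩

theorem IsFree.mem_touched_of_adj (hG : IsFree P1AddP5 G) {a b : V} (ha : a ∈ touched G x y A B)
    (hb : b ∈ rest x y A B) (hab : G.Adj a b) : b ∈ touched G x y A B :=
  hG.mem_ball_of_adj Set.inter_subset_right ha hb hab

theorem middle_subset : middle G x y A B ⊆ rest x y A B := fun _ hv => touched_subset hv.1

theorem IsFree.mem_middle_of_adj (hG : IsFree P1AddP5 G) {a b : V} (ha : a ∈ middle G x y A B)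
    (hb : b ∈ rest x y A B) (hab : G.Adj a b) : b ∈ middle G x y A B :=
  ⟨hG.mem_touched_of_adj ha.1 hb hab,
    hG.mem_touched_of_adj ha.2 (by rwa [rest_comm]) hab⟩

/-- Every component of the rest that is adjacent to `A` has a neighbour of `A`. -/
theorem exists_mem_nbr_of_touched {v : V} (hv : v ∈ touched G x y A B) {P : V → Prop}
    (hP : ∀ a ∈ rest x y A B, ∀ b ∈ rest x y A B, G.Adj a b → P a → P b) (hPv : P v) :
    ∃ b ∈ rest x y A B, P b ∧ ∃ a ∈ A, G.Adj a b := by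
  by_contra! h
  refine ball_induction (P := fun v => ¬ P v) ?_ ?_ v hv hPv
  · rintro b ⟨⟨a, ha, hab⟩, hb⟩ hPb
    exact h b hb hPb a ha hab
  · exact fun a ha b _ hb hab hPa hPb => hPa (hP b hb a (touched_subset ha) hab.symm hPb)

theorem IsFree.conn_side (hG : IsFree P1AddP5 G) (hA : Conn G A) : Conn G (side G x y A B) := by
  refine conn_of_attached hA Set.subset_union_left fun v hv P hP hPv => ?_
  rcases hv with hv | hv
  · exact ⟨v, hv, hPv⟩
  by_contra! h
  have h1 : ∀ v ∈ touched G x y A B, v ∉ touched G y x B A → ¬ P v := by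
    refine ball_induction ?_ ?_
    · rintro b ⟨⟨a, ha, hab⟩, hb⟩ hb' hPb
      exact h a ha (hP b (.inr ⟨mem_touched_of_mem ha hb hab, hb'⟩) a (.inl ha) hab.symm hPb)
    · intro a ha b hb hbR hab hPa hb' hPb
      have ha' : a ∉ touched G y x B A := fun ha' =>
        hb' (hG.mem_touched_of_adj ha' (by rwa [rest_comm]) hab)
      exact hPa ha' (hP b (.inr ⟨hb, hb'⟩) a (.inr ⟨ha, ha'⟩) hab.symm hPb)
  exact h1 v hv.1 hv.2 hPv

namespace Ends

theorem left_ne (h : Ends G k f x y A B) (hk : 5 ≤ k) {a b : V} (ha : a ∈ A) (hb : b ∈ B) :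
    a ≠ b ∧ ¬ G.Adj a b := by
  have h1 := h.left a ha
  have h2 := h.right b hb
  refine ⟨fun h => ?_, fun hab => ?_⟩
  · rw [h] at h1; omega
  · have := h.map.adj a b hab; omega

theorem value (h : Ends G k f x y A B) {v : V} (hv : v ∈ rest x y A B) : 1 ≤ f v ∧ f v + 2 ≤ k := by
  rw [mem_rest_iff] at hv
  have h1 := (h.eq_left v).not.2 hv.1
  have h2 := (h.eq_right v).not.2 hv.2.1
  have h3 := h.map.lt v
  omega

theorem mem_rest (h : Ends G k f x y A B) {v : V} (h2 : 2 ≤ f v) (h3 : f v + 3 ≤ k) :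
    v ∈ rest x y A B := by
  refine mem_rest_iff.2 ⟨fun e => ?_, fun e => ?_, fun hv => ?_, fun hv => ?_⟩
  · have := (h.eq_left v).2 e; omega
  · have := (h.eq_right v).2 e; omega
  · have := h.left v hv; omega
  · have := h.right v hv; omega

/-- A component of the rest has an edge leaving it, and this edge cannot go to `x` or `y`, whose
neighbours all lie in `A` and `B`. -/
theorem mem_touched_or (hG : IsFree P1AddP5 G) (hc : Conn G Set.univ) (h : Ends G k f x y A B)
    {v : V} (hv : v ∈ rest x y A B) : v ∈ touched G x y A B ∨ v ∈ touched G y x B A := by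
  by_contra hv'
  obtain ⟨a, -, b, -, hab, ⟨haR, ha⟩, hb⟩ := hc.exists_crossing
    (fun v => v ∈ rest x y A B ∧ ¬ (v ∈ touched G x y A B ∨ v ∈ touched G y x B A)) (u := v) (v := x)
    trivial trivial ⟨hv, hv'⟩ fun h => (mem_rest_iff.1 h.1).1 rfl
  have haR' := mem_rest_iff.1 haR
  have haR'' : a ∈ rest y x B A := by rwa [rest_comm]
  by_cases hbR : b ∈ rest x y A B
  · refine hb ⟨hbR, fun hb => ha ?_⟩
    exact hb.imp (fun h => hG.mem_touched_of_adj h haR hab.symm)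
      (fun h => hG.mem_touched_of_adj h haR'' hab.symm)
  · rw [mem_rest_iff] at hbR
    by_cases h1 : b = x
    · subst h1; exact haR'.2.2.1 (h.nbr_left a hab.symm)
    by_cases h2 : b = y
    · subst h2; exact haR'.2.2.2 (h.nbr_right a hab.symm)
    by_cases h3 : b ∈ A
    · exact ha (.inl (mem_touched_of_mem h3 haR hab.symm))
    · have h4 : b ∈ B := by tauto
      exact ha (.inr (mem_touched_of_mem h4 haR'' hab.symm))

/-- There are no edges from `A` to `B` or `y`, because the bags `1` and `k - 2` are at least two
apart. That only `A` itself sends edges to the middle part is needed for `k = 6`. -/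
theorem adj_side (hG : IsFree P1AddP5 G) (h : Ends G k f x y A B) (hk : 5 ≤ k) {u v : V}
    (hu : u ∈ side G x y A B) (huv : G.Adj u v) :
    v = x ∨ v ∈ side G x y A B ∨ (v ∈ middle G x y A B ∧ u ∈ A) := by
  rcases hu with hu | ⟨hu, hu'⟩
  · by_cases hvR : v ∈ rest x y A B
    · have h1 : v ∈ touched G x y A B := mem_touched_of_mem hu hvR huv
      by_cases h2 : v ∈ touched G y x B A
      · exact .inr (.inr ⟨⟨h1, h2⟩, hu⟩)
      · exact .inr (.inl (.inr ⟨h1, h2⟩))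
    · rw [mem_rest_iff] at hvR
      have h1 : v ≠ y := by
        rintro rfl
        exact (h.left_ne hk hu (h.nbr_right u huv.symm)).1 rfl
      have h2 : v ∉ B := fun hv => (h.left_ne hk hu hv).2 huv
      have h3 : v = x ∨ v ∈ A := by tauto
      exact h3.imp id fun h => .inl (.inl h)
  · have huR := touched_subset hu
    have huR' := mem_rest_iff.1 huR
    by_cases hvR : v ∈ rest x y A B
    · have h1 := hG.mem_touched_of_adj hu hvR huv
      refine .inr (.inl (.inr ⟨h1, fun h2 => hu' ?_⟩))
      exact hG.mem_touched_of_adj h2 (by rwa [rest_comm]) huv.symm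
    · rw [mem_rest_iff] at hvR
      have h1 : v ≠ y := by
        rintro rfl
        exact huR'.2.2.2 (h.nbr_right u huv.symm)
      have h2 : v ∉ B := fun hv => hu' (mem_touched_of_mem hv (by rwa [rest_comm]) huv.symm)
      have h3 : v = x ∨ v ∈ A := by tauto
      exact h3.imp id fun h => .inl (.inl h)

theorem adj_middle (hG : IsFree P1AddP5 G) (h : Ends G k f x y A B) {u v : V}
    (hu : u ∈ middle G x y A B) (huv : G.Adj u v) : v ∈ middle G x y A B ∨ v ∈ A ∨ v ∈ B := by
  by_cases hvR : v ∈ rest x y A B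
  · exact .inl (hG.mem_middle_of_adj hu hvR huv)
  · have huR := mem_rest_iff.1 (middle_subset hu)
    rw [mem_rest_iff] at hvR
    have h1 : v ≠ x := by rintro rfl; exact huR.2.2.1 (h.nbr_left u huv.symm)
    have h2 : v ≠ y := by rintro rfl; exact huR.2.2.2 (h.nbr_right u huv.symm)
    tauto

/-- Every component of the middle part meets the bags that are not adjacent to an end bag. -/
theorem exists_mem_middle (hG : IsFree P1AddP5 G) (h : Ends G k f x y A B) (hk : 5 ≤ k)
    {P : V → Prop} (hP : ∀ a ∈ middle G x y A B, ∀ b ∈ middle G x y A B, G.Adj a b → P a → P b)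
    {u : V} (hu : u ∈ middle G x y A B) (hPu : P u) :
    ∃ m ∈ middle G x y A B, P m ∧ 2 ≤ f m ∧ f m + 3 ≤ k := by
  by_contra! hcon
  -- A component of the middle part avoiding the inner bags would lie in the bags `1` and `k - 2`,
  -- hence in one of them, these being nonadjacent. But it has neighbours both in `A` and in `B`.
  have hval : ∀ v ∈ middle G x y A B, P v → f v = 1 ∨ f v + 2 = k := by
    intro v hv hPv
    have h1 := h.value (middle_subset hv)
    have h2 := hcon v hv hPv
    omega
  have hcl : ∀ c, c = 1 ∨ c + 2 = k → ∀ a ∈ rest x y A B, ∀ b ∈ rest x y A B, G.Adj a b →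
      (a ∈ middle G x y A B ∧ P a ∧ f a = c) → (b ∈ middle G x y A B ∧ P b ∧ f b = c) := by
    rintro c hc a - b hb hab ⟨ha, hPa, hfa⟩
    have hb' := hG.mem_middle_of_adj ha hb hab
    have hPb := hP a ha b hb' hab hPa
    refine ⟨hb', hPb, ?_⟩
    have h1 := hval b hb' hPb
    have h2 := h.map.adj a b hab
    have h3 := h.map.adj b a hab.symm
    omega
  rcases hval u hu hPu with h1 | h1
  · obtain ⟨b, -, ⟨-, -, hb⟩, a, ha, hab⟩ := exists_mem_nbr_of_touched hu.2
      (P := fun v => v ∈ middle G x y A B ∧ P v ∧ f v = 1)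
      (by rw [rest_comm]; exact hcl 1 (.inl rfl)) ⟨hu, hPu, h1⟩
    have h2 := h.right a ha
    have h3 := h.map.adj b a hab.symm
    omega
  · obtain ⟨b, -, ⟨-, -, hb⟩, a, ha, hab⟩ := exists_mem_nbr_of_touched hu.1
      (hcl (f u) (.inr h1)) ⟨hu, hPu, rfl⟩
    have h2 := h.left a ha
    have h3 := h.map.adj a b hab
    omega

/-- Otherwise no edge would leave `{x}` together with the first side, although `y` is outside. -/
theorem middle_nonempty (hG : IsFree P1AddP5 G) (hc : Conn G Set.univ) (h : Ends G k f x y A B)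
    (hk : 5 ≤ k) : (middle G x y A B).Nonempty := by
  have hxy : y ≠ x := by
    rintro rfl
    have h1 := (h.eq_left y).2 rfl
    have h2 := (h.eq_right y).2 rfl
    omega
  have hy : y ∉ side G x y A B := by
    rintro (hy | hy)
    · have h1 := h.left y hy
      have h2 := (h.eq_right y).2 rfl
      omega
    · exact (mem_rest_iff.1 (touched_subset hy.1)).2.1 rfl
  obtain ⟨a, -, b, -, hab, ha, hb⟩ := hc.exists_crossing (fun v => v = x ∨ v ∈ side G x y A B)
    (u := x) (v := y) trivial trivial (.inl rfl) fun h => h.elim hxy hy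
  rcases ha with rfl | ha
  · exact absurd (.inr (.inl (h.nbr_left b hab))) hb
  · rcases h.adj_side hG hk ha hab with h1 | h1 | h1
    · exact absurd (.inl h1) hb
    · exact absurd (.inr h1) hb
    · exact ⟨b, h1.1⟩

/-- The middle part contains the bags that are not adjacent to an end bag. -/
theorem mem_middle (hG : IsFree P1AddP5 G) (hc : Conn G Set.univ) (h : Ends G k f x y A B)
    (hk : 5 ≤ k) (hmid : Conn G {v | 2 ≤ f v ∧ f v + 3 ≤ k}) {v : V} (h2 : 2 ≤ f v)
    (h3 : f v + 3 ≤ k) : v ∈ middle G x y A B := by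
  obtain ⟨u, hu⟩ := h.middle_nonempty hG hc hk
  obtain ⟨m, hm, -, hm2, hm3⟩ := h.exists_mem_middle hG hk (P := fun _ => True) (by simp) hu trivial
  refine hmid (fun v => v ∈ middle G x y A B) (fun a _ b hb hab ha => ?_) m ⟨hm2, hm3⟩ v ⟨h2, h3⟩ hm
  exact hG.mem_middle_of_adj ha (h.mem_rest hb.1 hb.2) hab

/-- The inner bags form a connected subset of the middle part, and every component of the middle
part meets them. -/
theorem conn_middle (hG : IsFree P1AddP5 G) (hc : Conn G Set.univ) (h : Ends G k f x y A B)
    (hk : 5 ≤ k) (hmid : Conn G {v | 2 ≤ f v ∧ f v + 3 ≤ k}) : Conn G (middle G x y A B) := by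
  refine conn_of_attached hmid (fun v hv => h.mem_middle hG hc hk hmid hv.1 hv.2) ?_
  intro v hv P hP hPv
  obtain ⟨m, -, hPm, hm⟩ := h.exists_mem_middle hG hk hP hv hPv
  exact ⟨m, hm, hPm⟩

theorem not_mem (h : Ends G k f x y A B) (hk : 5 ≤ k) :
    x ≠ y ∧ x ∉ side G x y A B ∧ y ∉ side G x y A B := by
  have h1 := (h.eq_left x).2 rfl
  have h2 := (h.eq_right y).2 rfl
  refine ⟨fun e => by rw [e] at h1; omega, ?_, ?_⟩
  · rintro (hx | hx)
    · have := h.left x hx; omega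
    · exact (mem_rest_iff.1 (touched_subset hx.1)).1 rfl
  · rintro (hx | hx)
    · have := h.left y hx; omega
    · exact (mem_rest_iff.1 (touched_subset hx.1)).2.1 rfl

theorem not_mem_middle_of_side {v : V} (hv : v ∈ side G x y A B) :
    v ∉ middle G x y A B := by
  rintro ⟨h1, h2⟩
  rcases hv with hv | hv
  · exact (mem_rest_iff.1 (touched_subset h1)).2.2.1 hv
  · exact hv.2 h2

/-- The last but one bag is going to consist of all vertices left over; this identifies it with the
mirror image of the first side, which is known to be connected. -/
theorem other_side (hG : IsFree P1AddP5 G) (hc : Conn G Set.univ) (h : Ends G k f x y A B)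
    (hk : 5 ≤ k) {v : V} : v ∈ side G y x B A ↔
      v ≠ x ∧ v ≠ y ∧ v ∉ side G x y A B ∧ v ∉ middle G x y A B := by
  constructor
  · intro hv
    have h1 := (h.reverse hk).not_mem hk
    refine ⟨fun e => h1.2.2 (e ▸ hv), fun e => h1.2.1 (e ▸ hv), fun hv' => ?_, fun hv' => ?_⟩
    · rcases hv with hv | hv <;> rcases hv' with hv' | hv'
      · exact (h.left_ne hk hv' hv).1 rfl
      · exact (mem_rest_iff.1 (touched_subset hv'.1)).2.2.2 hv
      · exact (mem_rest_iff.1 (touched_subset hv.1)).2.2.2 hv'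
      · exact hv.2 hv'.1
    · rw [← middle_comm] at hv'
      exact not_mem_middle_of_side hv hv'
  · rintro ⟨h1, h2, h3, h4⟩
    by_cases h5 : v ∈ B
    · exact .inl h5
    · have hv : v ∈ rest x y A B := mem_rest_iff.2 ⟨h1, h2, fun hv => h3 (.inl hv), h5⟩
      refine .inr ⟨?_, fun h6 => ?_⟩
      · refine (h.mem_touched_or hG hc hv).resolve_left fun h6 => ?_
        by_cases h7 : v ∈ touched G y x B A
        · exact h4 ⟨h6, h7⟩
        · exact h3 (.inr ⟨h6, h7⟩)
      · by_cases h7 : v ∈ touched G y x B A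
        · exact h4 ⟨h6, h7⟩
        · exact h3 (.inr ⟨h6, h7⟩)

end Ends

end Middle

end LongestPathContractibility

/-! ### Path contractions given by lists of sets. -/

namespace LongestPathContractibility

open Function

section Ranks

variable {V : Type*} {G : SimpleGraph V}

/-- No bag between the ends can be empty: the graph is connected and values increase by at most one
along an edge. -/
theorem isPathMap_of_ends (hc : Conn G Set.univ) {k : ℕ} {f : V → ℕ} {x y : V} (hx : f x = 0)
    (hy : f y + 1 = k) (hlt : ∀ v, f v < k) (hconn : ∀ i < k, Conn G {v | f v = i})
    (hadj : ∀ u v, G.Adj u v → f v ≤ f u + 1) : IsPathMap G k f := by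
  refine ⟨hlt, fun i hi => ?_, fun i => ?_, hadj⟩
  · rcases Nat.eq_zero_or_pos i with rfl | hi'
    · exact ⟨x, hx⟩
    obtain ⟨a, -, b, -, hab, ha, hb⟩ := hc.exists_crossing (fun v => f v < i) (u := x) (v := y)
      trivial trivial (by omega) (by omega)
    have := hadj a b hab
    exact ⟨b, by omega⟩
  · by_cases hi : i < k
    · exact hconn i hi
    · rintro P - u hu
      have hu : f u = i := hu
      exact absurd (hu ▸ hlt u) hi

variable {x y : V} {S M C : Set V}

/-- Here and in the longer lists, the final entry `{y}ᶜ` collects all vertices not yet placed, and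
`y` alone falls off the end and gets the last rank. -/
theorem isPathMap_rank_three (hc : Conn G Set.univ) (hxy : x ≠ y) (hadj : ¬ G.Adj x y)
    (hconn : Conn G ({x} ∪ {y})ᶜ) : IsPathMap G 3 (rank [{x}, {y}ᶜ]) := by
  classical
  have hr : ∀ v, rank [{x}, {y}ᶜ] v = if v = x then 0 else if v = y then 2 else 1 := by
    intro v
    simp only [rank, Set.mem_singleton_iff, Set.mem_compl_iff]
    split_ifs <;> rfl
  refine isPathMap_of_ends hc (x := x) (y := y) (by grind) (by grind) (by grind) ?_ ?_
  · intro i hi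
    interval_cases i
    · convert conn_singleton (G := G) x using 1; ext v; simp only [Set.mem_ofPred_eq, hr]; grind
    · convert hconn using 1; ext v; simp only [Set.mem_ofPred_eq, hr]; grind
    · convert conn_singleton (G := G) y using 1; ext v; simp only [Set.mem_ofPred_eq, hr]; grind
  · intro u v huv
    rw [hr, hr]
    grind

theorem isPathMap_rank_four (hc : Conn G Set.univ) (hxy : x ≠ y) (hxS : x ∉ S) (hyS : y ∉ S)
    (hS : Conn G S) (hrest : Conn G (({x} ∪ {y})ᶜ \ S)) (h1 : ∀ v, G.Adj x v → v ∈ S)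
    (h2 : ∀ u ∈ S, ¬ G.Adj u y) : IsPathMap G 4 (rank [{x}, S, {y}ᶜ]) := by
  classical
  have hr : ∀ v, rank [{x}, S, {y}ᶜ] v =
      if v = x then 0 else if v ∈ S then 1 else if v = y then 3 else 2 := by
    intro v
    simp only [rank, Set.mem_singleton_iff, Set.mem_compl_iff]
    split_ifs <;> rfl
  refine isPathMap_of_ends hc (x := x) (y := y) (by grind) (by grind) (by grind) ?_ ?_
  · intro i hi
    interval_cases i
    · convert conn_singleton (G := G) x using 1; ext v; simp only [Set.mem_ofPred_eq, hr]; grind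
    · convert hS using 1; ext v; simp only [Set.mem_ofPred_eq, hr]; grind
    · convert hrest using 1; ext v; simp only [Set.mem_ofPred_eq, hr]; grind
    · convert conn_singleton (G := G) y using 1; ext v; simp only [Set.mem_ofPred_eq, hr]; grind
  · intro u v huv
    rw [hr, hr]
    have := h1 v
    have := h2 u
    grind

theorem isPathMap_rank_five (hc : Conn G Set.univ) (hxy : x ≠ y) (hxS : x ∉ S) (hyS : y ∉ S)
    (hxM : x ∉ M) (hyM : y ∉ M) (hSM : ∀ v ∈ S, v ∉ M) (hS : Conn G S) (hM : Conn G M)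
    (hrest : Conn G {v | v ≠ x ∧ v ≠ y ∧ v ∉ S ∧ v ∉ M}) (h1 : ∀ v, G.Adj x v → v ∈ S)
    (h2 : ∀ u ∈ S, ∀ v, G.Adj u v → v = x ∨ v ∈ S ∨ v ∈ M) (h3 : ∀ u ∈ M, ¬ G.Adj u y) :
    IsPathMap G 5 (rank [{x}, S, M, {y}ᶜ]) := by
  classical
  have hr : ∀ v, rank [{x}, S, M, {y}ᶜ] v =
      if v = x then 0 else if v ∈ S then 1 else if v ∈ M then 2 else if v = y then 4 else 3 := by
    intro v
    simp only [rank, Set.mem_singleton_iff, Set.mem_compl_iff]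
    split_ifs <;> rfl
  refine isPathMap_of_ends hc (x := x) (y := y) (by grind) (by grind) (by grind) ?_ ?_
  · intro i hi
    interval_cases i
    · convert conn_singleton (G := G) x using 1; ext v; simp only [Set.mem_ofPred_eq, hr]; grind
    · convert hS using 1; ext v; simp only [Set.mem_ofPred_eq, hr]; grind
    · convert hM using 1; ext v; simp only [Set.mem_ofPred_eq, hr]; grind
    · convert hrest using 1; ext v; simp only [Set.mem_ofPred_eq, hr]; grind
    · convert conn_singleton (G := G) y using 1; ext v; simp only [Set.mem_ofPred_eq, hr]; grind
  · intro u v huv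
    rw [hr, hr]
    have := h1 v
    have := h2 u
    have := h3 u
    grind

theorem isPathMap_rank_six (hc : Conn G Set.univ) (hxy : x ≠ y) (hxS : x ∉ S) (hyS : y ∉ S)
    (hxM : x ∉ M) (hyM : y ∉ M) (hSM : ∀ v ∈ S, v ∉ M) (hCM : C ⊆ M) (hS : Conn G S)
    (hC : Conn G C) (hM : Conn G (M \ C))
    (hrest : Conn G {v | v ≠ x ∧ v ≠ y ∧ v ∉ S ∧ v ∉ M}) (h1 : ∀ v, G.Adj x v → v ∈ S)
    (h2 : ∀ u ∈ S, ∀ v, G.Adj u v → v = x ∨ v ∈ S ∨ v ∈ C)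
    (h3 : ∀ u ∈ C, ∀ v, G.Adj u v → v ∈ S ∨ v ∈ M) (h4 : ∀ u ∈ M, ¬ G.Adj u y) :
    IsPathMap G 6 (rank [{x}, S, C, M, {y}ᶜ]) := by
  classical
  have hr : ∀ v, rank [{x}, S, C, M, {y}ᶜ] v =
      if v = x then 0 else if v ∈ S then 1 else if v ∈ C then 2 else if v ∈ M then 3
      else if v = y then 5 else 4 := by
    intro v
    simp only [rank, Set.mem_singleton_iff, Set.mem_compl_iff]
    split_ifs <;> rfl
  have hCM' : ∀ v, v ∈ C → v ∈ M := fun v hv => hCM hv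
  refine isPathMap_of_ends hc (x := x) (y := y) (by grind) (by grind) (by grind) ?_ ?_
  · intro i hi
    interval_cases i
    · convert conn_singleton (G := G) x using 1; ext v; simp only [Set.mem_ofPred_eq, hr]; grind
    · convert hS using 1; ext v; simp only [Set.mem_ofPred_eq, hr]; grind
    · convert hC using 1; ext v; simp only [Set.mem_ofPred_eq, hr]; grind
    · convert hM using 1; ext v; simp only [Set.mem_ofPred_eq, hr]; grind
    · convert hrest using 1; ext v; simp only [Set.mem_ofPred_eq, hr]; grind
    · convert conn_singleton (G := G) y using 1; ext v; simp only [Set.mem_ofPred_eq, hr]; grind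
  · intro u v huv
    rw [hr, hr]
    have := h1 v
    have := h2 u
    have := h3 u
    have := h4 u
    grind

end Ranks

/-! ### Every contractible graph has a contraction determined by ten vertices. -/

section Labels

variable {V : Type*} (G : SimpleGraph V)

/-- The neighbours of `X` in `U`, together with `s` and `t`. -/
def joined (X U : Set V) (s t : V) : Set V := nbr G X ∩ U ∪ ({s} ∪ {t})

/-- The candidate bags that are computed from a tuple of vertices; each bag consists of the vertices
in the respective set that are in no earlier set, and the last bag of all remaining vertices. -/
def labels (t : Fin 10 → V) : ℕ → List (Set V)
  | 2 => [{t 0}]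
  | 3 => [{t 0}, {t 1}ᶜ]
  | 4 => [{t 0}, split G ({t 0} ∪ {t 1})ᶜ (joined G {t 0} Set.univ (t 2) (t 3))
      (joined G {t 1} Set.univ (t 4) (t 5)), {t 1}ᶜ]
  | 5 => [{t 0},
      side G (t 0) (t 1) (joined G {t 0} Set.univ (t 2) (t 3)) (joined G {t 1} Set.univ (t 4) (t 5)),
      middle G (t 0) (t 1) (joined G {t 0} Set.univ (t 2) (t 3))
        (joined G {t 1} Set.univ (t 4) (t 5)), {t 1}ᶜ]
  | 6 =>
      let A := joined G {t 0} Set.univ (t 2) (t 3)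
      let B := joined G {t 1} Set.univ (t 4) (t 5)
      let M := middle G (t 0) (t 1) A B
      [{t 0}, side G (t 0) (t 1) A B,
        split G M (joined G A M (t 6) (t 7)) (joined G B M (t 8) (t 9)), M, {t 1}ᶜ]
  | _ => []

variable {G} {k : ℕ} {f : V → ℕ} {x y : V}

/-- The two connecting vertices are found in a set `W` that depends on an unknown contraction; the
definable set `U` can replace it, having the same intersection with the neighbourhood. -/
theorem joined_of_conn_nbr {X U W : Set V} {s t : V} (h : nbr G X ∩ W = nbr G X ∩ U)
    (hc : Conn G (nbr G X ∩ W ∪ {s, t})) : Conn G (joined G X U s t) := by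
  rw [h] at hc
  exact hc

/-- The neighbours of the first end of a contraction to a path with at least four bags can be
connected within the second bag by two vertices. -/
theorem IsFree.exists_joined [Finite V] (hG : IsFree P1AddP5 G) (hc : Conn G Set.univ)
    (hf : IsPathMap G k f) (hk : 4 ≤ k) (hx : ∀ v, f v = 0 ↔ v = x) (hy : f y = k - 1) :
    ∃ s t, Conn G (joined G {x} Set.univ s t) ∧ ∀ v ∈ joined G {x} Set.univ s t, f v = 1 := by
  have hx0 : f x = 0 := (hx x).2 rfl
  have hnbr : ∀ v, G.Adj x v → f v = 1 := fun v hv => by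
    have h1 := hf.adj x v hv
    have h2 := (hx v).not.2 hv.ne'
    omega
  have hfar : ∀ v, f v ≤ 1 → v ≠ y ∧ ¬ G.Adj y v := fun v hv => by
    refine ⟨fun e => ?_, fun hyv => ?_⟩
    · rw [e] at hv; omega
    · have := hf.adj v y hyv.symm; omega
  have hset : nbr G {x} ∩ {v | f v = 1} = nbr G {x} ∩ Set.univ := by
    ext v
    simp only [Set.mem_inter_iff, Set.mem_univ, and_true, and_iff_left_iff_imp]
    rintro ⟨_, rfl, hv⟩
    exact hnbr v hv
  obtain ⟨a, b, ha, hb, hab⟩ := hf.exists_adj hc (i := 0) (by omega)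
  obtain rfl : a = x := (hx a).1 ha
  obtain ⟨s, hs, t, ht, hst⟩ := hG.exists_conn_nbr (X := {a}) (W := {v | f v = 1}) (y := y)
    (conn_singleton a) (hf.conn 1) (by rintro _ rfl; exact hfar _ (by omega))
    (fun v hv => hfar v (le_of_eq hv)) ⟨b, ⟨a, rfl, hab⟩, hb⟩
  refine ⟨s, t, joined_of_conn_nbr hset hst, ?_⟩
  rintro v (⟨⟨_, rfl, hv⟩, -⟩ | rfl | rfl)
  exacts [hnbr v hv, hs, ht]

theorem IsFree.exists_ends [Finite V] (hG : IsFree P1AddP5 G) (hc : Conn G Set.univ)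
    (hf : IsPathMap G k f) (hk : 4 ≤ k) : ∃ f x y s₁ s₂ t₁ t₂,
      Ends G k f x y (joined G {x} Set.univ s₁ s₂) (joined G {y} Set.univ t₁ t₂) := by
  obtain ⟨f, hf, x, y, hxy⟩ := hf.exists_singletons hc (by omega)
  obtain ⟨s₁, s₂, hs, hs'⟩ := hG.exists_joined hc hf hk (fun v => (hxy v).1) ((hxy y).2.2 rfl)
  have hlt := hf.lt
  obtain ⟨t₁, t₂, ht, ht'⟩ := hG.exists_joined hc hf.reverse hk (x := y) (y := x)
    (fun v => by rw [← (hxy v).2]; have := hlt v; omega) (by rw [(hxy x).1.2 rfl]; omega)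
  refine ⟨f, x, y, s₁, s₂, t₁, t₂, hf, fun v => (hxy v).1, fun v => (hxy v).2, hs, ht, hs',
    fun v hv => ?_, fun v hv => .inl ⟨⟨x, rfl, hv⟩, trivial⟩, fun v hv => .inl ⟨⟨y, rfl, hv⟩, trivial⟩⟩
  have h1 := ht' v hv
  omega

theorem exists_labels_three [Finite V] (hc : Conn G Set.univ) (hf : IsPathMap G 3 f) :
    ∃ t, IsPathMap G 3 (rank (labels G t 3)) := by
  obtain ⟨f, hf, x, y, hxy⟩ := hf.exists_singletons hc (by omega)
  refine ⟨![x, y, x, x, x, x, x, x, x, x], isPathMap_rank_three hc (x := x) (y := y) ?_ ?_ ?_⟩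
  · rintro rfl
    have h1 := (hxy x).1.2 rfl
    have h2 := (hxy x).2.2 rfl
    omega
  · intro h
    have h1 := (hxy x).1.2 rfl
    have h2 := (hxy y).2.2 rfl
    have := hf.adj x y h
    omega
  · convert hf.conn 1 using 1
    ext v
    have h1 := hxy v
    have h2 := hf.lt v
    simp only [Set.mem_compl_iff, Set.mem_union, Set.mem_singleton_iff, Set.mem_ofPred_eq, ← h1.1,
      ← h1.2]
    omega

/-- The two inner bags together form the connected set `U` of all vertices but `x` and `y`. They
contain the disjoint connected sets `A` and `B`, so `split` cuts `U` into connected parts around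
these. -/
theorem IsFree.exists_labels_four [Finite V] (hG : IsFree P1AddP5 G) (hc : Conn G Set.univ)
    (hf : IsPathMap G 4 f) : ∃ t, IsPathMap G 4 (rank (labels G t 4)) := by
  obtain ⟨f, x, y, s₁, s₂, t₁, t₂, h⟩ := hG.exists_ends hc hf le_rfl
  set A := joined G {x} Set.univ s₁ s₂
  set B := joined G {y} Set.univ t₁ t₂
  set U : Set V := ({x} ∪ {y})ᶜ
  have hU : U = {v | f v = 1} ∪ {v | f v = 2} := by
    ext v
    have h1 := h.eq_left v
    have h2 := h.eq_right v
    have h3 := h.map.lt v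
    simp only [U, Set.mem_compl_iff, Set.mem_union, Set.mem_singleton_iff, Set.mem_ofPred_eq, ← h1,
      ← h2]
    omega
  obtain ⟨a, b, ha, hb, hab⟩ := h.map.exists_adj hc (i := 1) (by omega)
  have hUc : Conn G U := by
    rw [hU]; exact (h.map.conn 1).union (h.map.conn 2) ha hb hab
  have hAU : A ⊆ U := fun v hv => by rw [hU]; exact .inl (h.left v hv)
  have hBU : B ⊆ U := fun v hv => by rw [hU]; exact .inr (h.right v hv)
  have hAB : Disjoint A B := by
    rw [Set.disjoint_left]
    intro v hv hv'
    have h1 := h.left v hv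
    have h2 := h.right v hv'
    omega
  have hAne : A.Nonempty := ⟨s₁, .inr (.inl rfl)⟩
  have hsub := split_subset (G := G) (D := B) hAU
  have hdis := Set.disjoint_left.1 (disjoint_split (G := G) (U := U) hAB)
  refine ⟨![x, y, s₁, s₂, t₁, t₂, x, x, x, x], isPathMap_rank_four hc (x := x) (y := y)
    (S := split G U A B) ?_ (fun hx => ?_) (fun hy => ?_) (conn_split h.conn_left)
    (hG.conn_diff_split hUc h.conn_right hAU hBU hAB hAne)
    (fun v hv => .inl (h.nbr_left v hv)) fun u hu huy => hdis hu (h.nbr_right u huy.symm)⟩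
  · rintro rfl
    have h1 := (h.eq_left x).2 rfl
    have h2 := (h.eq_right x).2 rfl
    omega
  · exact hsub hx (.inl rfl)
  · exact hsub hy (.inr rfl)

theorem IsFree.exists_labels_five [Finite V] (hG : IsFree P1AddP5 G) (hc : Conn G Set.univ)
    (hf : IsPathMap G 5 f) : ∃ t, IsPathMap G 5 (rank (labels G t 5)) := by
  obtain ⟨f, x, y, s₁, s₂, t₁, t₂, h⟩ := hG.exists_ends hc hf (by omega)
  set A := joined G {x} Set.univ s₁ s₂
  set B := joined G {y} Set.univ t₁ t₂
  have hmid : Conn G {v | 2 ≤ f v ∧ f v + 3 ≤ 5} := by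
    convert h.map.conn 2 using 3
    omega
  obtain ⟨hxy, hxS, hyS⟩ := h.not_mem le_rfl
  refine ⟨![x, y, s₁, s₂, t₁, t₂, x, x, x, x], isPathMap_rank_five hc (x := x) (y := y)
    (S := side G x y A B) (M := middle G x y A B) hxy hxS hyS
    (fun hx => (mem_rest_iff.1 (middle_subset hx)).1 rfl)
    (fun hy => (mem_rest_iff.1 (middle_subset hy)).2.1 rfl)
    (fun v => Ends.not_mem_middle_of_side) (hG.conn_side h.conn_left)
    (h.conn_middle hG hc le_rfl hmid) ?_ (fun v hv => .inl (h.nbr_left v hv))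
    (fun u hu v huv => (h.adj_side hG le_rfl hu huv).imp id fun h => h.imp id fun h => h.1)
    fun u hu huy => (mem_rest_iff.1 (middle_subset hu)).2.2.2 (h.nbr_right u huy.symm)⟩
  convert hG.conn_side (x := y) (y := x) (A := B) (B := A) h.conn_right using 1
  ext v
  exact (h.other_side hG hc le_rfl).symm

theorem IsPathMap.conn_inner (hc : Conn G Set.univ) (hf : IsPathMap G 6 f) :
    Conn G {v | 2 ≤ f v ∧ f v + 3 ≤ 6} := by
  obtain ⟨a, b, ha, hb, hab⟩ := hf.exists_adj hc (i := 2) (by omega)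
  convert (hf.conn 2).union (hf.conn 3) ha hb hab using 1
  ext v
  simp only [Set.mem_union, Set.mem_ofPred_eq]
  omega

/-- The neighbours of the first side in the middle part of a contraction to a path with six bags can
be connected within the third bag by two vertices. -/
theorem Ends.exists_joined_middle [Finite V] (hG : IsFree P1AddP5 G) (hc : Conn G Set.univ)
    {A B : Set V} (h : Ends G 6 f x y A B) :
    ∃ s t, Conn G (joined G A (middle G x y A B) s t) ∧
      ∀ v ∈ joined G A (middle G x y A B) s t, v ∈ middle G x y A B ∧ f v ≤ 2 := by
  have hmid := h.map.conn_inner hc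
  have hnbr : ∀ a ∈ A, ∀ v, G.Adj a v → f v ≤ 2 := fun a ha v hav => by
    have h1 := h.left a ha
    have h2 := h.map.adj a v hav
    omega
  -- This half contains bag `2`. A component of it missing bag `2` would lie in bag `1` and so be a
  -- component of the whole middle part, which is impossible by `exists_mem_middle`.
  have hhalf : Conn G {v | v ∈ middle G x y A B ∧ f v ≤ 2} := by
    refine conn_of_attached (A := {v | f v = 2}) (h.map.conn 2)
      (fun v hv => ⟨h.mem_middle hG hc (by omega) hmid (le_of_eq hv.symm)
        (by rw [show f v = 2 from hv]; omega), le_of_eq hv⟩) fun v hv P hP hPv => ?_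
    by_contra! hcon
    have hone : ∀ v ∈ middle G x y A B, f v ≤ 2 → P v → f v = 1 := fun v hv hv2 hPv => by
      have h1 := h.value (middle_subset hv)
      have h2 : f v ≠ 2 := fun h2 => hcon v h2 hPv
      omega
    obtain ⟨m, -, ⟨hm1, -⟩, hm2, -⟩ := h.exists_mem_middle hG (by omega)
      (P := fun v => f v = 1 ∧ P v) (fun a ha b hb hab ⟨ha1, hPa⟩ => by
        have h1 := h.map.adj a b hab
        have hPb := hP a ⟨ha, by omega⟩ b ⟨hb, by omega⟩ hab hPa
        exact ⟨hone b hb (by omega) hPb, hPb⟩) hv.1 ⟨hone v hv.1 hv.2 hPv, hPv⟩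
    omega
  have hfar : ∀ v, f v ≤ 2 → v ≠ y ∧ ¬ G.Adj y v := fun v hv => by
    have h1 := (h.eq_right y).2 rfl
    refine ⟨fun e => ?_, fun hyv => ?_⟩
    · rw [e] at hv; omega
    · have := h.map.adj v y hyv.symm; omega
  have hset : nbr G A ∩ {v | v ∈ middle G x y A B ∧ f v ≤ 2} = nbr G A ∩ middle G x y A B := by
    ext v
    constructor
    · exact fun ⟨h1, h2⟩ => ⟨h1, h2.1⟩
    · rintro ⟨⟨a, ha, hav⟩, h2⟩
      exact ⟨⟨a, ha, hav⟩, h2, hnbr a ha v hav⟩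
  have hne : (nbr G A ∩ middle G x y A B).Nonempty := by
    obtain ⟨m, hm⟩ := h.middle_nonempty hG hc (by omega)
    obtain ⟨b, -, hb, a, ha, hab⟩ := exists_mem_nbr_of_touched hm.1
      (P := fun v => v ∈ middle G x y A B)
      (fun a _ b hb hab ha => hG.mem_middle_of_adj ha hb hab) hm
    exact ⟨b, ⟨a, ha, hab⟩, hb⟩
  -- The vertex `y` is in bag `5`, so neither `y` nor a neighbour of it lies in the bags up to `2`.
  obtain ⟨s, hs, t, ht, hst⟩ := hG.exists_conn_nbr (y := y) h.conn_left hhalf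
    (fun v hv => hfar v (by rw [h.left v hv]; omega)) (fun v hv => hfar v hv.2) (by rwa [hset])
  refine ⟨s, t, joined_of_conn_nbr hset hst, ?_⟩
  rintro v (⟨⟨a, ha, hav⟩, hv⟩ | rfl | rfl)
  exacts [⟨hv, hnbr a ha v hav⟩, hs, ht]

theorem IsFree.exists_labels_six [Finite V] (hG : IsFree P1AddP5 G) (hc : Conn G Set.univ)
    (hf : IsPathMap G 6 f) : ∃ t, IsPathMap G 6 (rank (labels G t 6)) := by
  obtain ⟨f, x, y, s₁, s₂, t₁, t₂, h⟩ := hG.exists_ends hc hf (by omega)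
  set A := joined G {x} Set.univ s₁ s₂
  set B := joined G {y} Set.univ t₁ t₂
  obtain ⟨s₃, s₄, hC, hC'⟩ := h.exists_joined_middle hG hc
  obtain ⟨t₃, t₄, hD, hD'⟩ := (h.reverse (by omega)).exists_joined_middle hG hc
  rw [middle_comm] at hD hD'
  set M := middle G x y A B with hMdef
  set C := joined G A M s₃ s₄ with hCdef
  set D := joined G B M t₃ t₄ with hDdef
  have hmid := h.map.conn_inner hc
  have hM : Conn G M := h.conn_middle hG hc (by omega) hmid
  have hCM : C ⊆ M := fun v hv => (hC' v hv).1
  have hDM : D ⊆ M := fun v hv => (hD' v hv).1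
  -- `C` lies in the bags up to `2` and, by reversal, `D` in the bags from `3` on. As `C` and `D`
  -- contain all neighbours of `A` and of `B` in `M`, the two parts of the cut have no edges to the
  -- wrong side.
  have hCD : Disjoint C D := by
    rw [Set.disjoint_left]
    intro v hv hv'
    have h1 := (hC' v hv).2
    have h2 := (hD' v hv').2
    omega
  have hsub := split_subset (G := G) (D := D) hCM
  have hdis := Set.disjoint_left.1 (disjoint_split (G := G) (U := M) hCD)
  obtain ⟨hxy, hxS, hyS⟩ := h.not_mem (by omega)
  refine ⟨![x, y, s₁, s₂, t₁, t₂, s₃, s₄, t₃, t₄], isPathMap_rank_six hc (x := x) (y := y)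
    (S := side G x y A B) (M := M) (C := split G M C D) hxy hxS hyS
    (fun hx => (mem_rest_iff.1 (middle_subset hx)).1 rfl)
    (fun hy => (mem_rest_iff.1 (middle_subset hy)).2.1 rfl)
    (fun v => Ends.not_mem_middle_of_side) hsub (hG.conn_side h.conn_left)
    (conn_split hC) (hG.conn_diff_split hM hD hCM hDM hCD ⟨s₃, .inr (.inl rfl)⟩) ?_
    (fun v hv => .inl (h.nbr_left v hv)) (fun u hu v huv => ?_) (fun u hu v huv => ?_)
    fun u hu huy => (mem_rest_iff.1 (middle_subset hu)).2.2.2 (h.nbr_right u huy.symm)⟩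
  · convert hG.conn_side (x := y) (y := x) (A := B) (B := A) h.conn_right using 1
    ext v
    exact (h.other_side hG hc (by omega)).symm
  · refine (h.adj_side hG (by omega) hu huv).imp id fun h => h.imp id fun h => ?_
    exact .inl (.inl ⟨⟨u, h.2, huv⟩, h.1⟩)
  · rcases h.adj_middle hG (hsub hu) huv with h1 | h1 | h1
    · exact .inr h1
    · exact .inl (.inl h1)
    · exact absurd (.inl ⟨⟨v, h1, huv.symm⟩, hsub hu⟩) (hdis hu)

theorem isPathMap_one (hc : Conn G Set.univ) (v : V) : IsPathMap G 1 (rank ([] : List (Set V))) := by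
  refine ⟨fun _ => Nat.one_pos, fun i hi => ⟨v, ?_⟩, fun i => ?_, fun u v _ => Nat.le_succ _⟩
  · simp only [rank]
    omega
  · intro P hP a ha b hb hPa
    have hi : 0 = i := ha
    exact hc P (fun a _ b _ => hP a hi b hi) a trivial b trivial hPa

theorem exists_labels_two [Finite V] (hc : Conn G Set.univ) (hf : IsPathMap G 2 f) :
    ∃ t, IsPathMap G 2 (rank (labels G t 2)) := by
  classical
  obtain ⟨f, hf, -, -, x, hx⟩ := hf.exists_singleton hc le_rfl
  refine ⟨fun _ => x, ?_⟩
  have e : rank (labels G (fun _ => x) 2) = f := by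
    funext v
    have h1 := hx v
    have h2 := hf.lt v
    simp only [labels, rank, Set.mem_singleton_iff, ← h1]
    split_ifs <;> omega
  rwa [e]

/-- A `(P₁ + P₅)`-free graph that can be contracted to a path can be contracted to it in one of
polynomially many ways. -/
theorem IsFree.exists_labels [Finite V] (hG : IsFree P1AddP5 G) (hc : Conn G Set.univ)
    (hk : 0 < k) (hf : IsPathMap G k f) : ∃ t, IsPathMap G k (rank (labels G t k)) := by
  have hk6 := hG.le_six hc hf
  interval_cases k
  · obtain ⟨v, -⟩ := hf.surj 0 Nat.one_pos
    exact ⟨fun _ => v, isPathMap_one hc v⟩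
  · exact exists_labels_two hc hf
  · exact exists_labels_three hc hf
  · exact hG.exists_labels_four hc hf
  · exact hG.exists_labels_five hc hf
  · exact hG.exists_labels_six hc hf

end Labels

end LongestPathContractibility

/-! ### The digest of `k`, definability of the candidate bags, and the conclusion. -/

namespace LongestPathContractibility

open Function

section Digest

theorem foldl_digestStep_zero (l : List Bool) : l.foldl digestStep 0 = 0 := by
  induction l with
  | nil => rfl
  | cons b l ih => exact ih

theorem foldl_digestStep_of_le {q : Fin 16} (hq : 8 ≤ (q : ℕ)) {l : List Bool} (hl : l ≠ []) :
    l.foldl digestStep q = 0 := by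
  cases l with
  | nil => exact absurd rfl hl
  | cons b l =>
    have : digestStep q b = 0 := by simp [digestStep, hq]
    rw [List.foldl_cons, this, foldl_digestStep_zero]

theorem digest_coe (p : PosNum) : digest (p : ℕ) = (encodePosNum p).foldl digestStep 1 := by
  have h : ((p : ℕ) : Num) = Num.pos p := Num.of_to_nat (Num.pos p)
  simp only [digest, encodeNat, h, encodeNum]

/-- Such a number has at least four binary digits; three of them bring the digest to at least `8`,
and the next one makes it `0` for good. -/
theorem digest_of_le {k : ℕ} (hk : 8 ≤ k) : digest k = 0 := by
  obtain ⟨p, rfl⟩ : ∃ p : PosNum, (p : ℕ) = k := by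
    have h : (((k : Num) : ℕ)) = k := Num.to_of_nat k
    cases e : (k : Num) with
    | zero => rw [e] at h; simp at h; omega
    | pos p => rw [e] at h; exact ⟨p, h⟩
  rw [digest_coe]
  -- The three lowest digits are stripped off; numerals that end before a further digit are less
  -- than `8`.
  rcases p with _ | (_ | (_ | q | q) | (_ | q | q)) | (_ | (_ | q | q) | (_ | q | q)) <;>
    first
    | exact absurd hk (by decide)
    | change List.foldl digestStep (digestStep (digestStep (digestStep 1 _) _) _)
        (encodePosNum q) = 0
      exact foldl_digestStep_of_le (by decide) (encodePosNum_nonempty q)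

theorem digest_eq_iff {c : ℕ} (h1 : 0 < c) (h6 : c ≤ 6) {k : ℕ} (hk : 0 < k) :
    digest k = digest c ↔ k = c := by
  refine ⟨fun h => ?_, fun h => h ▸ rfl⟩
  rcases lt_or_ge k 8 with hk' | hk'
  · interval_cases c <;> interval_cases k <;> first | rfl | exact absurd h (by decide)
  · rw [digest_of_le hk'] at h
    interval_cases c <;> exact absurd h (by decide)

end Digest

section Definability

variable {W X : Type} {H : SimpleGraph W}

/-- All level sets of the rank function of a list of sets are definable. -/
def DefinableList (L : ∀ I : Instance H, (X → Fin I.n) → List (Set (Fin I.n))) : Prop :=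
  ∀ i : ℕ, DefinableSet fun I v => {a | rank (L I v) a = i}

theorem DefinableList.nil : DefinableList (H := H) (X := X) fun _ _ => [] := by
  rintro (_ | i)
  · exact DefinableSet.univ.congr fun I v => by simp [rank]
  · exact DefinableSet.univ.compl.congr fun I v => by simp [rank]

theorem DefinableList.cons {S : ∀ I : Instance H, (X → Fin I.n) → Set (Fin I.n)}
    {L : ∀ I : Instance H, (X → Fin I.n) → List (Set (Fin I.n))} (hS : DefinableSet S)
    (hL : DefinableList L) : DefinableList fun I v => S I v :: L I v := by
  rintro (_ | i)
  · exact hS.congr fun I v => by simp [rank]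
  · refine (hS.compl.inter (hL i)).congr fun I v => ?_
    by_cases h : v none ∈ S I fun x => v (some x) <;> simp [rank, h]

/-- Freeness enters here: it makes the first-order condition `IsBags` equivalent to being a path
contraction. -/
theorem DefinableList.isPathMap {k : ℕ}
    {L : ∀ I : Instance P1AddP5, (X → Fin I.n) → List (Set (Fin I.n))} (hL : DefinableList L) :
    Definable fun I v => IsPathMap I.G k (rank (L I v)) :=
  (Definable.isBags (k := k) fun i => hL i).congr fun I _ => I.free.isBags_iff

namespace DefinableSet

variable {S T U A B : ∀ I : Instance H, (X → Fin I.n) → Set (Fin I.n)}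

theorem joined (hS : DefinableSet S) (hU : DefinableSet U) (a b : X) :
    DefinableSet fun I v => joined I.G (S I v) (U I v) (v a) (v b) :=
  (hS.nbr.inter hU).union ((singleton a).union (singleton b))

theorem split (hU : DefinableSet U) (hS : DefinableSet S) (hT : DefinableSet T) :
    DefinableSet fun I v => split I.G (U I v) (S I v) (T I v) :=
  hS.union ((hU.sdiff (hS.union hT)).ball (hS.nbr.inter (hU.sdiff (hS.union hT))) 5)

theorem rest (a b : X) (hA : DefinableSet A) (hB : DefinableSet B) :
    DefinableSet fun I v => rest (v a) (v b) (A I v) (B I v) :=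
  (((singleton a).union (singleton b)).union (hA.union hB)).compl

theorem touched (a b : X) (hA : DefinableSet A) (hB : DefinableSet B) :
    DefinableSet fun I v => touched I.G (v a) (v b) (A I v) (B I v) :=
  (rest a b hA hB).ball (hA.nbr.inter (rest a b hA hB)) 5

theorem middle (a b : X) (hA : DefinableSet A) (hB : DefinableSet B) :
    DefinableSet fun I v => middle I.G (v a) (v b) (A I v) (B I v) :=
  (touched a b hA hB).inter (touched b a hB hA)

theorem side (a b : X) (hA : DefinableSet A) (hB : DefinableSet B) :
    DefinableSet fun I v => side I.G (v a) (v b) (A I v) (B I v) :=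
  hA.union ((touched a b hA hB).sdiff (touched b a hB hA))

end DefinableSet

theorem definableList_labels (k : ℕ) :
    DefinableList (H := H) fun I t => labels I.G t k := by
  have s : ∀ i : Fin 10, DefinableSet (H := H) fun I t => {t i} := DefinableSet.singleton
  have hA := (s 0).joined .univ 2 3
  have hB := (s 1).joined .univ 4 5
  have hM := DefinableSet.middle 0 1 hA hB
  match k with
  | 2 => exact .cons (s 0) .nil
  | 3 => exact .cons (s 0) (.cons (s 1).compl .nil)
  | 4 => exact .cons (s 0) (.cons (((s 0).union (s 1)).compl.split hA hB) (.cons (s 1).compl .nil))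
  | 5 => exact .cons (s 0) (.cons (.side 0 1 hA hB) (.cons hM (.cons (s 1).compl .nil)))
  | 6 =>
    exact .cons (s 0) (.cons (.side 0 1 hA hB) (.cons (hM.split (hA.joined hM 6 7) (hB.joined hM 8 9))
      (.cons hM (.cons (s 1).compl .nil))))
  | 0 | 1 | _ + 7 => exact .nil

/-- Because `k ≤ 6` in every yes-instance, a disjunction over six values suffices. For each of them
the digest recognises `k`, and ten existential quantifiers guess the vertices that determine the
bags. -/
theorem definable_isYes :
    Definable fun (I : Instance P1AddP5) (_ : Empty → Fin I.n) => I.IsYes := by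
  have h : Definable fun (I : Instance P1AddP5) (_ : Empty → Fin I.n) => ∃ c : Fin 6,
      digest I.k = digest (c + 1) ∧ ∃ t : Fin 10 → Fin I.n,
        IsPathMap I.G (c + 1) (rank (labels I.G t (c + 1))) :=
    .exists_fin fun c => .and (.digest_eq _) (.exists_tuple (definableList_labels _).isPathMap)
  refine h.congr fun I _ => ?_
  have hc := conn_univ_of_connected I.connected
  rw [Instance.IsYes, hasContraction_pathGraph_iff hc]
  constructor
  · rintro ⟨c, hk, t, ht⟩
    rw [digest_eq_iff (by omega) (by omega) I.k_pos] at hk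
    exact ⟨_, hk ▸ ht⟩
  · rintro ⟨f, hf⟩
    have h1 := I.k_pos
    have h6 := I.free.le_six hc hf
    obtain ⟨t, ht⟩ := I.free.exists_labels hc h1 hf
    refine ⟨⟨I.k - 1, by omega⟩, ?_⟩
    simp only [Nat.sub_add_cancel h1]
    exact ⟨trivial, t, ht⟩

end Definability

end LongestPathContractibility

theorem theorem5 :
    LongestPathContractibility.PolyTimeSolvable LongestPathContractibility.P1AddP5 := by
  classical
  obtain ⟨φ, hφ⟩ := LongestPathContractibility.definable_isYes
  exact LongestPathContractibility.polyTime_of_fml _ φ _ fun I => by rw [hφ, decide_eq_true_iff]
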